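/- Monoids are commutative and cancellative and are written additively. Let $S$ be a torsion-free monoid (that is, $ns=nt$ with $n\ge 1$ implies $s=t$) with quotient group $G$, and suppose that $G$ satisfies the ascending chain condition on cyclic subgroups. Let $D$ be an integral domain with quotient field $K$. Then the monoid algebra $D[S]$ is a weakly Krull domain if and only if - $S$ is a weakly Krull monoid and $S$ is $K$-UMT, and - $D$ is a weakly Krull domain and $D$ is $G$-UMT. Here the notions are as follows. For a domain $R$, let $\mathfrak X(R)$ be the set of height-one prime ideals of $R$; for a monoid $T$, let $\mathfrak X(T)$ be the set of minimal non-empty prime ideals of $T$. A domain $R$ is *weakly Krull* if $R=\bigcap_{P\in\mathfrak X(R)}R_P$ (inside its quotient field; an empty intersection is the whole quotient field) and every non-zero non-unit of $R$ lies in only finitely many $P\in\mathfrak X(R)$. A monoid $T$ is *weakly Krull* if $T=\bigcap_{P\in\mathfrak X(T)}T_P$ (inside its quotient group; an empty intersection is the whole quotient group), where $T_P=\{a-b\mid a\in T,\ b\in T\setminus P\}$, and every non-unit of $T$ lies in only finitely many $P\in\mathfrak X(T)$. Let $R$ be a domain with quotient field $F$ and let $T$ be a torsion-free monoid with quotient group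 $H$. For an ideal $P$ of $R$, let $P[T]$ be the set of elements of $R[T]$ with all coefficients in $P$; for an ideal $P$ of $T$, let $R[P]$ be the set of elements of $R[T]$ with all exponents in $P$. Then $R$ is *$T$-UMT* if $$\mathfrak X(R[T])=\{P[T]\mid P\in\mathfrak X(R)\}\cup\{Q\cap R[T]\mid Q\in\mathfrak X(F[T])\},$$ and $T$ is *$R$-UMT* if $$\mathfrak X(R[T])=\{R[P]\mid P\in\mathfrak X(T)\}\cup\{Q\cap R[T]\mid Q\in\mathfrak X(R[H])\}.$$ -/

import Mathlib

namespace MonoidAlgebraUMT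

open Algebra

section Rings

/-- The height-one spectrum of a commutative ring. -/
def heightOneSpectrum (R : Type*) [CommRing R] : Set (Ideal R) :=
  {P | P.IsPrime ∧ P.height = 1}

/-- The localization of `R` at `P`, as a subset of the quotient field of `R`: all fractions `a / s`
with `a ∈ R` and `s ∈ R \ P`. -/
def ringLocalizationAt {R : Type*} [CommRing R] (P : Ideal R) : Set (FractionRing R) :=
  {z | ∃ a s : R, s ∉ P ∧ z * algebraMap R (FractionRing R) s = algebraMap R (FractionRing R) a}

/-- `R` is a weakly Krull domain: a domain that is the intersection of its localizations at the
height-one primes, and in which every non-zero non-unit lies in only finitely many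
height-one primes. -/
structure IsWeaklyKrullDomain (R : Type*) [CommRing R] : Prop where
  isDomain : IsDomain R
  iInter_localization :
    ⋂ P ∈ heightOneSpectrum R, ringLocalizationAt P = Set.range (algebraMap R (FractionRing R))
  finite_character : ∀ x : R, x ≠ 0 → ¬ IsUnit x → {P ∈ heightOneSpectrum R | x ∈ P}.Finite

end Rings

section Monoids

variable {S : Type*} [AddCancelCommMonoid S]

/-- A (possibly empty) ideal of an additively written monoid is prime if it is proper and contains
one of the summands of every sum that it contains. -/
structure IsPrimeIdeal (P : AddSemigroupIdeal S) : Prop where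
  ne_univ : (P : Set S) ≠ Set.univ
  mem_or_mem : ∀ {a b : S}, a + b ∈ P → a ∈ P ∨ b ∈ P

variable (S) in
/-- The minimal non-empty prime ideals of a monoid. -/
def minimalPrimeIdeals : Set (AddSemigroupIdeal S) :=
  {P | Minimal (fun Q : AddSemigroupIdeal S => IsPrimeIdeal Q ∧ (Q : Set S).Nonempty) P}

/-- The localization of `S` at `P`, as a subset of the quotient group of `S`: all differences
`a - b` with `a ∈ S` and `b ∈ S \ P`. -/
def monoidLocalizationAt (P : AddSemigroupIdeal S) : Set (GrothendieckAddGroup S) :=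
  {g | ∃ a b : S, b ∉ P ∧ g = GrothendieckAddGroup.of a - GrothendieckAddGroup.of b}

variable (S) in
/-- `S` is a weakly Krull monoid: it is the intersection of its localizations at the minimal
non-empty primes, and every non-unit lies in only finitely many of these primes. -/
structure IsWeaklyKrullMonoid : Prop where
  iInter_localization :
    ⋂ P ∈ minimalPrimeIdeals S, monoidLocalizationAt P =
      Set.range (GrothendieckAddGroup.of : S →+ GrothendieckAddGroup S)
  finite_character : ∀ x : S, ¬ IsAddUnit x → {P ∈ minimalPrimeIdeals S | x ∈ P}.Finite

end Monoids

section MonoidAlgebras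

variable {D S : Type*} [CommRing D] [AddCancelCommMonoid S]

variable (S) in
/-- The ideal `P[S]` of `D[S]`: all elements with coefficients in the ideal `P` of `D`. -/
def coeffIdeal (P : Ideal D) : Ideal (AddMonoidAlgebra D S) where
  carrier := {f | ∀ s, f.coeff s ∈ P}
  zero_mem' := fun s => by simp
  add_mem' := fun hf hg s => by simpa using P.add_mem (hf s) (hg s)
  smul_mem' := fun c f hf s => by
    classical
    rw [smul_eq_mul, AddMonoidAlgebra.coeff_mul]
    refine P.sum_mem fun a _ => P.sum_mem fun b _ => ?_
    dsimp only
    split_ifs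
    · exact P.mul_mem_left _ (hf b)
    · exact P.zero_mem

variable (D) in
/-- The ideal `D[P]` of `D[S]`: all elements whose exponents lie in the ideal `P` of `S`. -/
def exponentIdeal (P : AddSemigroupIdeal S) : Ideal (AddMonoidAlgebra D S) where
  carrier := {f | ∀ s, f.coeff s ≠ 0 → s ∈ P}
  zero_mem' := fun s hs => by simp at hs
  add_mem' := fun {f g} hf hg s hs => by
    by_cases h : f.coeff s = 0
    · exact hg s (by simpa [h] using hs)
    · exact hf s h
  smul_mem' := fun c f hf s hs => by
    classical
    rw [smul_eq_mul, AddMonoidAlgebra.coeff_mul] at hs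
    obtain ⟨a, _, ha⟩ := Finset.exists_ne_zero_of_sum_ne_zero hs
    obtain ⟨b, hb, hab⟩ := Finset.exists_ne_zero_of_sum_ne_zero ha
    dsimp only at hab
    split_ifs at hab with h
    · rw [← h]
      exact AddSemigroupIdeal.add_mem P a (hf b (Finsupp.mem_support_iff.mp hb))
    · exact absurd rfl hab

variable (D S) in
/-- The inclusion `D[S] → K[S]`, where `K` is the quotient field of `D`. -/
noncomputable def toFractionAlgebra :
    AddMonoidAlgebra D S →+* AddMonoidAlgebra (FractionRing D) S :=
  AddMonoidAlgebra.mapRingHom S (algebraMap D (FractionRing D))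

variable (D S) in
/-- The inclusion `D[S] → D[G]`, where `G` is the quotient group of `S`. -/
noncomputable def toGroupAlgebra :
    AddMonoidAlgebra D S →+* AddMonoidAlgebra D (GrothendieckAddGroup S) :=
  AddMonoidAlgebra.mapDomainRingHom D (GrothendieckAddGroup.of : S →+ GrothendieckAddGroup S)

/-- `D` is `S`-UMT: the height-one primes of `D[S]` are exactly the ideals `P[S]` for height-one
primes `P` of `D` and the ideals `Q ∩ D[S]` for height-one primes `Q` of `K[S]`, where `K` is the
quotient field of `D`. -/
def IsUMTDomain (D S : Type*) [CommRing D] [AddCancelCommMonoid S] : Prop :=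
  heightOneSpectrum (AddMonoidAlgebra D S) =
    {I | ∃ P ∈ heightOneSpectrum D, I = coeffIdeal S P} ∪
    {I | ∃ Q ∈ heightOneSpectrum (AddMonoidAlgebra (FractionRing D) S),
      I = Q.comap (toFractionAlgebra D S)}

/-- `S` is `D`-UMT: the height-one primes of `D[S]` are exactly the ideals `D[P]` for minimal
non-empty primes `P` of `S` and the ideals `Q ∩ D[S]` for height-one primes `Q` of `D[G]`, where
`G` is the quotient group of `S`. -/
def IsUMTMonoid (S D : Type*) [AddCancelCommMonoid S] [CommRing D] : Prop :=
  heightOneSpectrum (AddMonoidAlgebra D S) =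
    {I | ∃ P ∈ minimalPrimeIdeals S, I = exponentIdeal D P} ∪
    {I | ∃ Q ∈ heightOneSpectrum (AddMonoidAlgebra D (GrothendieckAddGroup S)),
      I = Q.comap (toGroupAlgebra D S)}

end MonoidAlgebras

/-- The ascending chain condition on cyclic subgroups of an additive group. -/
def ACCOnCyclicSubgroups (G : Type*) [AddGroup G] : Prop :=
  WellFoundedGT {H : AddSubgroup G // ∃ g : G, H = AddSubgroup.zmultiples g}

end MonoidAlgebraUMT

set_option linter.unusedSectionVars false

namespace MonoidAlgebraUMT

open Algebra

/-! ### Height-one primes and weakly Krull domains -/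

section HeightOne

variable {R : Type*} [CommRing R] [IsDomain R]

/-! Inverting the monomials turns `D[S]` into `D[G]`, and inverting the non-zero constants turns it
into `K[S]`. Hence a height-one prime of `D[S]` containing a monomial is some `D[P]`, one containing
a non-zero constant is some `P[S]`, and every other one is contracted from `K[G]`. It follows that
the two UMT conditions say no more than that all `D[P]`, respectively all `P[S]`, have height one.

If `D[S]` is weakly Krull, each non-zero element of a prime `p` lies in a height-one prime below `p`
(`IsWeaklyKrullDomain.exists_heightOne_le`). For a monomial in `D[P]` or a constant in `P[S]` this
yields the UMT conditions; divisibility between monomials, or between constants, then makes `S` and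
`D` weakly Krull.

Conversely, `K[G]` is factorial, hence weakly Krull, so a fraction that lies in all localizations of
`D[S]` is an element of `K[G]`. Two Gauss lemmas resting on unique sums
(`coeff_mem_ringLocalizationAt`, `mem_monoidLocalizationAt_of_mul`) put its coefficients in every
`D_P` and its exponents in every `S_P`, hence the fraction in `D[S]`. Finite character is checked on
the three kinds of primes.

Factoriality of `K[G]` has two halves. Every element is primal, by reduction to polynomial rings.
Divisor chains terminate because generic functionals draw the exponents in a plane, where each
non-monomial factor of `f` contributes to an edge of the Newton polygon of `f`; the condition on
cyclic subgroups bounds how often an edge can be subdivided (`card_le_of_eq_mul_prod`). -/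

lemma mem_heightOneSpectrum_iff {P : Ideal R} :
    P ∈ heightOneSpectrum R ↔
      P.IsPrime ∧ P ≠ ⊥ ∧ ∀ Q : Ideal R, Q.IsPrime → Q ≠ ⊥ → Q ≤ P → Q = P := by
  constructor
  · rintro ⟨hP, h1⟩
    refine ⟨hP, Ideal.ne_bot_of_height_eq_one h1, fun Q hQ hQ0 hQP => ?_⟩
    by_contra hne
    have := (Ideal.height_le_iff (p := P) (n := 1)).1 h1.le Q hQ (lt_of_le_of_ne hQP hne)
    rw [Nat.cast_one, Order.lt_one_iff, Ideal.height_eq_zero_iff_eq_bot] at this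
    exact hQ0 this
  · rintro ⟨hP, h0, hmin⟩
    refine ⟨hP, le_antisymm ?_ ?_⟩
    · rw [← Nat.cast_one, Ideal.height_le_iff]
      intro Q hQ hQP
      rw [Nat.cast_one, Order.lt_one_iff, Ideal.height_eq_zero_iff_eq_bot]
      by_contra hQ0
      exact hQP.ne (hmin Q hQ hQ0 hQP.le)
    · rw [Order.one_le_iff_ne_zero, Ne, Ideal.height_eq_zero_iff_eq_bot]
      exact h0

/-- A height-one prime is, locally, the radical of each of its non-zero elements. -/
lemma exists_dvd_mul_pow_of_mem_heightOneSpectrum {P : Ideal R} (hP : P ∈ heightOneSpectrum R)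
    {x n : R} (hx0 : x ≠ 0) (hx : x ∈ P) (hn : n ∈ P) : ∃ k : ℕ, ∃ t ∉ P, x ∣ t * n ^ k := by
  obtain ⟨hPp, -, hmin⟩ := mem_heightOneSpectrum_iff.1 hP
  by_contra! hcon
  -- A prime that contains `x` and avoids both `R \ P` and the powers of `n` is non-zero and
  -- strictly below `P`, against height one.
  have hdisj : Disjoint ((Ideal.span {x} : Ideal R) : Set R)
      ((P.primeCompl ⊔ Submonoid.powers n : Submonoid R) : Set R) := by
    rw [Set.disjoint_left]
    intro y hy hy'
    obtain ⟨t, ht, m, ⟨k, rfl⟩, rfl⟩ := Submonoid.mem_sup.1 hy'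
    exact hcon k t ht (Ideal.mem_span_singleton.1 hy)
  obtain ⟨Q, hQ, hxQ, hQd⟩ := Ideal.exists_le_prime_disjoint _ _ hdisj
  have hxQ' : x ∈ Q := hxQ (Ideal.mem_span_singleton_self x)
  have hQP : Q ≤ P := fun y hy => by
    by_contra hyP
    exact Set.disjoint_left.1 hQd hy
      ((le_sup_left : P.primeCompl ≤ P.primeCompl ⊔ Submonoid.powers n) hyP)
  have hQ0 : Q ≠ ⊥ := fun h => hx0 (by simpa [h] using hxQ')
  have := hmin Q hQ hQ0 hQP
  subst this
  exact Set.disjoint_left.1 hQd hn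
    ((le_sup_right : Submonoid.powers n ≤ Q.primeCompl ⊔ Submonoid.powers n)
      (Submonoid.mem_powers n))

/-- The intersection condition, in terms of divisibility. -/
lemma isWeaklyKrullDomain_iff :
    IsWeaklyKrullDomain R ↔
      (∀ a b : R, b ≠ 0 → (∀ P ∈ heightOneSpectrum R, ∃ s ∉ P, b ∣ s * a) → b ∣ a) ∧
      ∀ x : R, x ≠ 0 → ¬ IsUnit x → {P ∈ heightOneSpectrum R | x ∈ P}.Finite := by
  have hinj := IsFractionRing.injective R (FractionRing R)
  constructor
  · rintro ⟨-, h1, h2⟩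
    refine ⟨fun a b hb h => ?_, h2⟩
    have hb' : algebraMap R (FractionRing R) b ≠ 0 := by simpa using hb
    have : algebraMap R (FractionRing R) a / algebraMap R (FractionRing R) b ∈
        ⋂ P ∈ heightOneSpectrum R, ringLocalizationAt P := by
      refine Set.mem_iInter₂.2 fun P hP => ?_
      obtain ⟨s, hs, c, hc⟩ := h P hP
      refine ⟨c, s, hs, ?_⟩
      rw [div_mul_eq_mul_div, div_eq_iff hb', ← map_mul, ← map_mul, mul_comm a, hc, mul_comm c]
    rw [h1] at this
    obtain ⟨c, hc⟩ := this
    rw [eq_div_iff hb', ← map_mul] at hc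
    exact ⟨c, by rw [← hinj hc, mul_comm]⟩
  · rintro ⟨h1, h2⟩
    refine ⟨inferInstance, Set.Subset.antisymm ?_ ?_, h2⟩
    · intro z hz
      obtain ⟨a, b, hb, rfl⟩ := IsFractionRing.div_surjective (A := R) z
      have hb0 : b ≠ 0 := nonZeroDivisors.ne_zero hb
      have hb' : algebraMap R (FractionRing R) b ≠ 0 := by simpa using hb0
      obtain ⟨c, rfl⟩ := h1 a b hb0 fun P hP => by
        obtain ⟨c, s, hs, h⟩ := Set.mem_iInter₂.1 hz P hP
        refine ⟨s, hs, c, hinj ?_⟩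
        rw [div_mul_eq_mul_div, div_eq_iff hb', ← map_mul, ← map_mul] at h
        rw [mul_comm s, h, mul_comm]
      exact ⟨c, by rw [map_mul, mul_div_cancel_left₀ _ hb']⟩
    · rintro _ ⟨c, rfl⟩
      refine Set.mem_iInter₂.2 fun P hP => ⟨c, 1, ?_, by simp⟩
      exact (Ideal.ne_top_iff_one P).1 hP.1.ne_top

/-- In a weakly Krull domain, a non-zero element of a prime ideal lies in a height-one prime
below it. -/
lemma IsWeaklyKrullDomain.exists_heightOne_le (hR : IsWeaklyKrullDomain R) {p : Ideal R}
    (hp : p.IsPrime) {x : R} (hx0 : x ≠ 0) (hx : x ∈ p) :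
    ∃ P ∈ heightOneSpectrum R, x ∈ P ∧ P ≤ p := by
  obtain ⟨h1, h2⟩ := isWeaklyKrullDomain_iff.1 hR
  by_contra! hcon
  have hxu : ¬ IsUnit x := fun hu => hp.ne_top (Ideal.eq_top_of_isUnit_mem _ hx hu)
  -- The product of the `m P` over the finitely many `P` containing `x` is divisible by `x` locally
  -- at every height-one prime, hence globally. So it lies in `p`, although no factor does.
  have key : ∀ P ∈ heightOneSpectrum R, ∃ m ∉ p, x ∈ P → ∃ t ∉ P, x ∣ t * m := by
    intro P hP
    by_cases hxP : x ∈ P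
    · obtain ⟨n, hnP, hnp⟩ := SetLike.not_le_iff_exists.1 (hcon P hP hxP)
      obtain ⟨k, t, ht, hd⟩ := exists_dvd_mul_pow_of_mem_heightOneSpectrum hP hx0 hxP hnP
      exact ⟨n ^ k, fun h => hnp (hp.mem_of_pow_mem k h), fun _ => ⟨t, ht, hd⟩⟩
    · exact ⟨1, (Ideal.ne_top_iff_one p).1 hp.ne_top, fun h => absurd h hxP⟩
  choose! m hm hmt using key
  set F := (h2 x hx0 hxu).toFinset with hF
  have hmem : ∀ P, P ∈ F ↔ P ∈ heightOneSpectrum R ∧ x ∈ P := fun P => by simp [hF]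
  have hprod : ∏ P ∈ F, m P ∉ p := by
    rw [hp.prod_mem_iff]
    rintro ⟨P, hP, hmP⟩
    exact hm P ((hmem P).1 hP).1 hmP
  refine hprod (Ideal.mem_of_dvd p (h1 _ x hx0 fun P hP => ?_) hx)
  by_cases hxP : x ∈ P
  · obtain ⟨t, ht, hd⟩ := hmt P hP hxP
    exact ⟨t, ht, hd.trans (mul_dvd_mul_left t (Finset.dvd_prod_of_mem m ((hmem P).2 ⟨hP, hxP⟩)))⟩
  · exact ⟨x, hxP, dvd_mul_right _ _⟩

lemma span_singleton_mem_heightOneSpectrum [UniqueFactorizationMonoid R] {p : R} (hp : Prime p) :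
    Ideal.span {p} ∈ heightOneSpectrum R := by
  refine mem_heightOneSpectrum_iff.2 ⟨(Ideal.span_singleton_prime hp.ne_zero).2 hp, ?_, ?_⟩
  · simpa using hp.ne_zero
  · intro Q hQ hQ0 hQp
    obtain ⟨q, hq, hqp⟩ := Ideal.IsPrime.exists_mem_prime_of_ne_bot hQ hQ0
    have hd : p ∣ q := Ideal.mem_span_singleton.1 (hQp hq)
    have := hp.associated_of_dvd hqp hd
    refine le_antisymm hQp ((Ideal.span_singleton_le_iff_mem _).2 ?_)
    exact Ideal.mem_of_dvd Q this.symm.dvd hq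

/-- The prime factors of `b` are cancelled one at a time: at `(p)` the multiplier `s` is prime to
`p`, so `p` divides `a`. A height-one prime containing `x` is generated by one of the prime factors
of `x`, which gives finiteness. -/
lemma isWeaklyKrullDomain_of_uniqueFactorizationMonoid [UniqueFactorizationMonoid R] :
    IsWeaklyKrullDomain R := by
  refine isWeaklyKrullDomain_iff.2 ⟨fun a b hb h => ?_, fun x hx0 _ => ?_⟩
  · replace h : ∀ p : R, Prime p → ∃ s, ¬ p ∣ s ∧ b ∣ s * a := fun p hp => by
      obtain ⟨s, hs, hd⟩ := h _ (span_singleton_mem_heightOneSpectrum hp)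
      exact ⟨s, fun h => hs (Ideal.mem_span_singleton.2 h), hd⟩
    induction b using UniqueFactorizationMonoid.induction_on_prime generalizing a with
    | h₁ => exact absurd rfl hb
    | h₂ u hu => exact hu.dvd
    | h₃ b p hb0 hp ih =>
      obtain ⟨s, hs, hd⟩ := h p hp
      obtain ⟨a, rfl⟩ := (hp.dvd_or_dvd ((dvd_mul_right p b).trans hd)).resolve_left hs
      refine mul_dvd_mul_left p (ih a hb0 fun q hq => ?_)
      obtain ⟨s, hs, hd⟩ := h q hq
      refine ⟨s, hs, (mul_dvd_mul_iff_left hp.ne_zero).1 ?_⟩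
      rwa [mul_left_comm] at hd
  · obtain ⟨f, hf, hfx⟩ := UniqueFactorizationMonoid.exists_prime_factors x hx0
    classical
    refine (f.toFinset.finite_toSet.image fun p => Ideal.span {p}).subset ?_
    rintro P ⟨hP, hxP⟩
    have hPp := hP.1
    have : f.prod ∈ P := Ideal.mem_of_dvd P hfx.symm.dvd hxP
    obtain ⟨p, hpf, hpP⟩ := (hPp.multiset_prod_mem_iff_exists_mem f).1 this
    exact ⟨p, by simpa using hpf, (Ideal.eq_span_singleton_of_height_eq_one hP.2 hpP (hf p hpf)).symm⟩

end HeightOne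

/-! ### Height one under localization -/

section Localization

variable {A B : Type*} [CommRing A] [CommRing B]

/-- Height-one primes under a localization map: contraction. -/
lemma comap_mem_heightOneSpectrum_iff (φ : A →+* B) (M : Submonoid A)
    (hφ : Function.Injective φ) (hu : ∀ m ∈ M, IsUnit (φ m))
    (hs : ∀ b, ∃ m ∈ M, ∃ a, b * φ m = φ a) {Q : Ideal B} (hQ : Q.IsPrime) :
    Q.comap φ ∈ heightOneSpectrum A ↔ Q ∈ heightOneSpectrum B := by
  let _ := φ.toAlgebra
  have : IsLocalization M B :=
    { map_units := fun m => hu m m.2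
      surj := fun b => by
        obtain ⟨m, hm, a, h⟩ := hs b
        exact ⟨(a, ⟨m, hm⟩), h⟩
      exists_of_eq := fun h => ⟨1, by rw [hφ h]⟩ }
  have h : (Q.comap φ).height = Q.height := IsLocalization.height_under M Q
  exact ⟨fun h' => ⟨hQ, h ▸ h'.2⟩, fun h' => ⟨hQ.comap φ, h.trans h'.2⟩⟩

/-- Height-one primes under a localization map: extension. -/
lemma exists_eq_comap_of_mem_heightOneSpectrum (φ : A →+* B) (M : Submonoid A)
    (hφ : Function.Injective φ) (hu : ∀ m ∈ M, IsUnit (φ m))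
    (hs : ∀ b, ∃ m ∈ M, ∃ a, b * φ m = φ a) {P : Ideal A} (hP : P ∈ heightOneSpectrum A)
    (hd : ∀ m ∈ M, m ∉ P) : ∃ Q ∈ heightOneSpectrum B, P = Q.comap φ := by
  let _ := φ.toAlgebra
  have : IsLocalization M B :=
    { map_units := fun m => hu m m.2
      surj := fun b => by
        obtain ⟨m, hm, a, h⟩ := hs b
        exact ⟨(a, ⟨m, hm⟩), h⟩
      exists_of_eq := fun h => ⟨1, by rw [hφ h]⟩ }
  have hdis : Disjoint (M : Set A) P := Set.disjoint_left.2 hd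
  have h1 : P = (P.map φ).comap φ :=
    (IsLocalization.under_map_of_isPrime_disjoint M B hP.1 hdis).symm
  have h2 : (P.map φ).IsPrime := IsLocalization.isPrime_of_isPrime_disjoint M B P hP.1 hdis
  exact ⟨_, (comap_mem_heightOneSpectrum_iff φ M hφ hu hs h2).1 (h1 ▸ hP), h1⟩

end Localization

/-! ### Torsion-free monoids and unique sums -/

section TorsionFree

variable {S : Type*} [AddCancelCommMonoid S]

lemma of_injective : Function.Injective (GrothendieckAddGroup.of : S →+ GrothendieckAddGroup S) :=
  GrothendieckAddGroup.of_injective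

lemma exists_eq_of_sub_of (g : GrothendieckAddGroup S) :
    ∃ a b : S, g = GrothendieckAddGroup.of a - GrothendieckAddGroup.of b := by
  obtain ⟨⟨a, b⟩, h⟩ := (AddLocalization.addMonoidOf (⊤ : AddSubmonoid S)).surj g
  exact ⟨a, b, eq_sub_of_add_eq h⟩

lemma of_sub_of_eq_iff {a b c d : S} :
    (GrothendieckAddGroup.of a - GrothendieckAddGroup.of b : GrothendieckAddGroup S) =
      GrothendieckAddGroup.of c - GrothendieckAddGroup.of d ↔ a + d = c + b := by
  rw [sub_eq_sub_iff_add_eq_add, ← map_add, ← map_add, of_injective.eq_iff]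

variable [IsAddTorsionFree S]

instance : IsAddTorsionFree (GrothendieckAddGroup S) where
  nsmul_right_injective n hn g h hgh := by
    obtain ⟨a, b, rfl⟩ := exists_eq_of_sub_of g
    obtain ⟨c, d, rfl⟩ := exists_eq_of_sub_of h
    simp only [smul_sub, ← map_nsmul, of_sub_of_eq_iff, ← smul_add] at hgh
    exact of_sub_of_eq_iff.2 (IsAddTorsionFree.nsmul_right_injective hn hgh)

/-- `S` embeds into its quotient group and that into its divisible hull, a rational vector space.
Unique sums make the monoid algebras over domains into domains and drive the primality and Gauss
arguments below. -/
instance : UniqueSums S :=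
  have : TwoUniqueSums S :=
    TwoUniqueSums.of_injective_addHom
      (((DivisibleHull.coeAddMonoidHom (GrothendieckAddGroup S)).comp
        (GrothendieckAddGroup.of : S →+ GrothendieckAddGroup S) :
          S →+ DivisibleHull (GrothendieckAddGroup S)) : S →ₙ+ DivisibleHull (GrothendieckAddGroup S))
      (DivisibleHull.coe_injective.comp of_injective) inferInstance
  inferInstance

end TorsionFree

/-! ### Monomials, the ideals `P[S]` and `D[P]`, and the localizations `D[G]` and `K[S]` -/

section MonoidAlgebra

variable {D S : Type*} [CommRing D] [AddCancelCommMonoid S]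

lemma mem_coeffIdeal {P : Ideal D} {f : AddMonoidAlgebra D S} :
    f ∈ coeffIdeal S P ↔ ∀ s, f.coeff s ∈ P := Iff.rfl

lemma mem_exponentIdeal {P : AddSemigroupIdeal S} {f : AddMonoidAlgebra D S} :
    f ∈ exponentIdeal D P ↔ ∀ s, f.coeff s ≠ 0 → s ∈ P := Iff.rfl

lemma single_mem_coeffIdeal {P : Ideal D} {s : S} {d : D} :
    AddMonoidAlgebra.single s d ∈ coeffIdeal S P ↔ d ∈ P := by
  classical
  refine ⟨fun h => by simpa using h s, fun h t => ?_⟩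
  rw [AddMonoidAlgebra.coeff_single, Finsupp.single_apply]
  split_ifs
  exacts [h, P.zero_mem]

lemma single_mem_exponentIdeal {P : AddSemigroupIdeal S} {s : S} {d : D} (hd : d ≠ 0) :
    AddMonoidAlgebra.single s d ∈ exponentIdeal D P ↔ s ∈ P := by
  classical
  refine ⟨fun h => h s (by simpa using hd), fun h t ht => ?_⟩
  rw [AddMonoidAlgebra.coeff_single, Finsupp.single_apply] at ht
  split_ifs at ht with hst
  exacts [hst ▸ h, absurd rfl ht]

lemma mem_of_forall_single_mem {I : Ideal (AddMonoidAlgebra D S)} {f : AddMonoidAlgebra D S}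
    (h : ∀ s, AddMonoidAlgebra.single s (f.coeff s) ∈ I) : f ∈ I := by
  rw [← AddMonoidAlgebra.sum_coeff_single f]
  exact I.sum_mem fun s _ => h s

lemma single_eq_mul (s : S) (d : D) :
    AddMonoidAlgebra.single s d =
      AddMonoidAlgebra.single (0 : S) d * AddMonoidAlgebra.single s (1 : D) := by
  rw [AddMonoidAlgebra.single_mul_single, zero_add, mul_one]

lemma coeffIdeal_le {P : Ideal D} {I : Ideal (AddMonoidAlgebra D S)}
    (h : ∀ d ∈ P, AddMonoidAlgebra.single 0 d ∈ I) : coeffIdeal S P ≤ I := fun f hf =>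
  mem_of_forall_single_mem fun s => by
    rw [single_eq_mul]
    exact I.mul_mem_right _ (h _ (hf s))

lemma exponentIdeal_le {P : AddSemigroupIdeal S} {I : Ideal (AddMonoidAlgebra D S)}
    (h : ∀ s ∈ P, AddMonoidAlgebra.single s 1 ∈ I) : exponentIdeal D P ≤ I := fun f hf =>
  mem_of_forall_single_mem fun s => by
    by_cases hs : f.coeff s = 0
    · rw [hs, AddMonoidAlgebra.single_zero]
      exact I.zero_mem
    · rw [single_eq_mul]
      exact I.mul_mem_left _ (h _ (hf s hs))

@[simp]
lemma toGroupAlgebra_single (s : S) (d : D) :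
    toGroupAlgebra D S (AddMonoidAlgebra.single s d) =
      AddMonoidAlgebra.single (GrothendieckAddGroup.of s) d :=
  AddMonoidAlgebra.mapDomain_single

@[simp]
lemma toFractionAlgebra_single (s : S) (d : D) :
    toFractionAlgebra D S (AddMonoidAlgebra.single s d) =
      AddMonoidAlgebra.single s (algebraMap D (FractionRing D) d) := by
  simp [toFractionAlgebra]

@[simp]
lemma coeff_toFractionAlgebra (f : AddMonoidAlgebra D S) (s : S) :
    (toFractionAlgebra D S f).coeff s = algebraMap D (FractionRing D) (f.coeff s) := by
  simp [toFractionAlgebra]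

@[simp]
lemma coeff_toGroupAlgebra_of (f : AddMonoidAlgebra D S) (s : S) :
    (toGroupAlgebra D S f).coeff (GrothendieckAddGroup.of s) = f.coeff s :=
  Finsupp.mapDomain_apply of_injective _ _

lemma exists_of_coeff_toGroupAlgebra_ne_zero {f : AddMonoidAlgebra D S}
    {g : GrothendieckAddGroup S} (h : (toGroupAlgebra D S f).coeff g ≠ 0) :
    ∃ s, g = GrothendieckAddGroup.of s ∧ f.coeff s ≠ 0 := by
  have : g ∈ Set.range (GrothendieckAddGroup.of : S →+ GrothendieckAddGroup S) := by
    by_contra hg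
    exact h (Finsupp.mapDomain_of_notMem_range _ _ hg)
  obtain ⟨s, rfl⟩ := this
  exact ⟨s, rfl, by rwa [coeff_toGroupAlgebra_of] at h⟩

lemma toGroupAlgebra_injective : Function.Injective (toGroupAlgebra D S) := fun f g h => by
  ext s
  rw [← coeff_toGroupAlgebra_of, h, coeff_toGroupAlgebra_of]

lemma mem_range_toGroupAlgebra {u : AddMonoidAlgebra D (GrothendieckAddGroup S)}
    (h : ∀ g, u.coeff g ≠ 0 → g ∈ Set.range (GrothendieckAddGroup.of : S →+ _)) :
    ∃ f, toGroupAlgebra D S f = u :=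
  ⟨AddMonoidAlgebra.comapDomain _ of_injective u, AddMonoidAlgebra.mapDomain_comapDomain
    (fun g hg => h g (Finsupp.mem_support_iff.1 hg)) of_injective⟩

lemma comap_toGroupAlgebra_coeffIdeal (P : Ideal D) :
    (coeffIdeal (GrothendieckAddGroup S) P).comap (toGroupAlgebra D S) = coeffIdeal S P := by
  ext f
  rw [Ideal.mem_comap, mem_coeffIdeal, mem_coeffIdeal]
  refine ⟨fun h s => coeff_toGroupAlgebra_of f s ▸ h (GrothendieckAddGroup.of s), fun h g => ?_⟩
  by_cases hg : (toGroupAlgebra D S f).coeff g = 0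
  · rw [hg]
    exact P.zero_mem
  · obtain ⟨s, rfl, -⟩ := exists_of_coeff_toGroupAlgebra_ne_zero hg
    rw [coeff_toGroupAlgebra_of]
    exact h s

section Localization

/-- Every element of `D[G]` becomes an element of `D[S]` after multiplication by a monomial. -/
lemma exists_mul_toGroupAlgebra_eq (u : AddMonoidAlgebra D (GrothendieckAddGroup S)) :
    ∃ m ∈ MonoidHom.mrange (AddMonoidAlgebra.of D S), ∃ f,
      u * toGroupAlgebra D S m = toGroupAlgebra D S f := by
  suffices ∃ s : S, ∃ f, u * toGroupAlgebra D S (AddMonoidAlgebra.single s 1) =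
      toGroupAlgebra D S f by
    obtain ⟨s, h⟩ := this
    exact ⟨_, ⟨Multiplicative.ofAdd s, rfl⟩, h⟩
  induction u using AddMonoidAlgebra.induction_linear with
  | zero => exact ⟨0, 0, by simp⟩
  | add u v hu hv =>
    obtain ⟨s, f, hf⟩ := hu
    obtain ⟨t, g, hg⟩ := hv
    refine ⟨s + t, f * AddMonoidAlgebra.single t 1 + g * AddMonoidAlgebra.single s 1, ?_⟩
    rw [map_add, map_mul, map_mul, ← hf, ← hg, add_mul, mul_assoc, mul_assoc, ← map_mul, ← map_mul,
      AddMonoidAlgebra.single_mul_single, AddMonoidAlgebra.single_mul_single, mul_one, add_comm t s]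
  | single g d =>
    obtain ⟨a, b, rfl⟩ := exists_eq_of_sub_of g
    exact ⟨b, AddMonoidAlgebra.single a d, by simp [AddMonoidAlgebra.single_mul_single]⟩

lemma isUnit_toGroupAlgebra {m : AddMonoidAlgebra D S}
    (hm : m ∈ MonoidHom.mrange (AddMonoidAlgebra.of D S)) : IsUnit (toGroupAlgebra D S m) := by
  obtain ⟨s, rfl⟩ := hm
  refine IsUnit.of_mul_eq_one (AddMonoidAlgebra.single (-GrothendieckAddGroup.of s.toAdd) 1) ?_
  simp [AddMonoidAlgebra.single_mul_single, AddMonoidAlgebra.one_def]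

lemma toFractionAlgebra_injective : Function.Injective (toFractionAlgebra D S) := fun f g h => by
  ext s
  apply IsFractionRing.injective D (FractionRing D)
  rw [← coeff_toFractionAlgebra, h, coeff_toFractionAlgebra]

variable [IsDomain D] in
/-- Every element of `K[S]` becomes an element of `D[S]` after multiplication by a constant. -/
lemma exists_mul_toFractionAlgebra_eq (u : AddMonoidAlgebra (FractionRing D) S) :
    ∃ m ∈ (nonZeroDivisors D).map (AddMonoidAlgebra.singleZeroRingHom : D →+* AddMonoidAlgebra D S),
      ∃ f, u * toFractionAlgebra D S m = toFractionAlgebra D S f := by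
  suffices ∃ d ∈ nonZeroDivisors D, ∃ f,
      u * toFractionAlgebra D S (AddMonoidAlgebra.single 0 d) = toFractionAlgebra D S f by
    obtain ⟨d, hd, h⟩ := this
    exact ⟨_, ⟨d, hd, rfl⟩, h⟩
  induction u using AddMonoidAlgebra.induction_linear with
  | zero => exact ⟨1, one_mem _, 0, by simp⟩
  | add u v hu hv =>
    obtain ⟨s, hs, f, hf⟩ := hu
    obtain ⟨t, ht, g, hg⟩ := hv
    refine ⟨s * t, mul_mem hs ht,
      f * AddMonoidAlgebra.single 0 t + g * AddMonoidAlgebra.single 0 s, ?_⟩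
    rw [map_add, map_mul, map_mul, ← hf, ← hg, add_mul, mul_assoc, mul_assoc, ← map_mul, ← map_mul,
      AddMonoidAlgebra.single_mul_single, AddMonoidAlgebra.single_mul_single, add_zero, mul_comm t s]
  | single g d =>
    obtain ⟨a, b, hb, rfl⟩ := IsFractionRing.div_surjective (A := D) d
    refine ⟨b, hb, AddMonoidAlgebra.single g a, ?_⟩
    have hb' : algebraMap D (FractionRing D) b ≠ 0 := by
      simpa using nonZeroDivisors.ne_zero hb
    simp [AddMonoidAlgebra.single_mul_single, div_mul_cancel₀ _ hb']

variable [IsDomain D] in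
lemma isUnit_toFractionAlgebra {m : AddMonoidAlgebra D S}
    (hm : m ∈ (nonZeroDivisors D).map
      (AddMonoidAlgebra.singleZeroRingHom : D →+* AddMonoidAlgebra D S)) :
    IsUnit (toFractionAlgebra D S m) := by
  obtain ⟨d, hd, rfl⟩ := hm
  have hd' : algebraMap D (FractionRing D) d ≠ 0 := by simpa using nonZeroDivisors.ne_zero hd
  refine IsUnit.of_mul_eq_one (AddMonoidAlgebra.single 0 (algebraMap D (FractionRing D) d)⁻¹) ?_
  simp [AddMonoidAlgebra.single_mul_single, AddMonoidAlgebra.one_def, mul_inv_cancel₀ hd']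

lemma comap_toFractionAlgebra_exponentIdeal (P : AddSemigroupIdeal S) :
    (exponentIdeal (FractionRing D) P).comap (toFractionAlgebra D S) = exponentIdeal D P := by
  ext f
  simp [Ideal.mem_comap, mem_exponentIdeal]

end Localization

end MonoidAlgebra

/-! ### Height-one primes of `D[S]` and the UMT conditions -/

section Primes

variable {D S : Type*} [CommRing D] [AddCancelCommMonoid S]

lemma coeffIdeal_eq_ker (P : Ideal D) :
    coeffIdeal S P = RingHom.ker (AddMonoidAlgebra.mapRingHom S (Ideal.Quotient.mk P)) := by
  ext f
  rw [mem_coeffIdeal, RingHom.mem_ker, ← AddMonoidAlgebra.coeff_inj, Finsupp.ext_iff]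
  simp [Ideal.Quotient.eq_zero_iff_mem]

lemma coeffIdeal_injective : Function.Injective (coeffIdeal S : Ideal D → _) := fun P Q h => by
  ext d
  rw [← single_mem_coeffIdeal (S := S) (s := 0), h, single_mem_coeffIdeal]

lemma exponentIdeal_injective [Nontrivial D] :
    Function.Injective (exponentIdeal D : AddSemigroupIdeal S → _) := fun P Q h => by
  ext s
  rw [← single_mem_exponentIdeal (D := D) one_ne_zero, h, single_mem_exponentIdeal one_ne_zero]

lemma IsPrimeIdeal.zero_notMem {P : AddSemigroupIdeal S} (hP : IsPrimeIdeal P) : (0 : S) ∉ P :=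
  fun h => hP.ne_univ (Set.eq_univ_of_forall fun s => by
    simpa using AddSemigroupIdeal.add_mem P s h)

/-- The exponents of the monomials in an ideal. -/
def monomialExponents (Q : Ideal (AddMonoidAlgebra D S)) : AddSemigroupIdeal S where
  carrier := {s | AddMonoidAlgebra.single s 1 ∈ Q}
  vadd_mem' := fun c {s} hs => by
    have := Q.mul_mem_left (AddMonoidAlgebra.single c 1) hs
    rwa [AddMonoidAlgebra.single_mul_single, mul_one] at this

lemma isPrimeIdeal_monomialExponents {Q : Ideal (AddMonoidAlgebra D S)} (hQ : Q.IsPrime) :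
    IsPrimeIdeal (monomialExponents Q) where
  ne_univ := fun h => hQ.ne_top ((Ideal.eq_top_iff_one _).2 (by
    have : (0 : S) ∈ (monomialExponents Q : Set S) := h ▸ Set.mem_univ _
    exact this))
  mem_or_mem := fun {a b} hab => hQ.mem_or_mem (by
    rw [AddMonoidAlgebra.single_mul_single, mul_one]
    exact hab)

lemma coeffIdeal_ne_bot {P : Ideal D} (h : P ≠ ⊥) : coeffIdeal S P ≠ ⊥ := by
  obtain ⟨d, hd, hd0⟩ := Submodule.exists_mem_ne_zero_of_ne_bot h
  intro h
  have : AddMonoidAlgebra.single (0 : S) d ∈ coeffIdeal S P := single_mem_coeffIdeal.2 hd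
  rw [h, Ideal.mem_bot] at this
  exact hd0 (AddMonoidAlgebra.single_eq_zero.1 this)

lemma exponentIdeal_ne_bot [Nontrivial D] {P : AddSemigroupIdeal S} (h : (P : Set S).Nonempty) :
    exponentIdeal D P ≠ ⊥ := by
  obtain ⟨s, hs⟩ := h
  intro h
  have : AddMonoidAlgebra.single s (1 : D) ∈ exponentIdeal D P :=
    (single_mem_exponentIdeal one_ne_zero).2 hs
  rw [h, Ideal.mem_bot] at this
  exact one_ne_zero (AddMonoidAlgebra.single_eq_zero.1 this)

lemma comap_toGroupAlgebra_mem_iff {Q : Ideal (AddMonoidAlgebra D (GrothendieckAddGroup S))}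
    (hQ : Q.IsPrime) :
    Q.comap (toGroupAlgebra D S) ∈ heightOneSpectrum (AddMonoidAlgebra D S) ↔
      Q ∈ heightOneSpectrum (AddMonoidAlgebra D (GrothendieckAddGroup S)) :=
  comap_mem_heightOneSpectrum_iff _ _ toGroupAlgebra_injective
    (fun _ => isUnit_toGroupAlgebra) exists_mul_toGroupAlgebra_eq hQ

lemma comap_toFractionAlgebra_mem_iff [IsDomain D] {Q : Ideal (AddMonoidAlgebra (FractionRing D) S)}
    (hQ : Q.IsPrime) :
    Q.comap (toFractionAlgebra D S) ∈ heightOneSpectrum (AddMonoidAlgebra D S) ↔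
      Q ∈ heightOneSpectrum (AddMonoidAlgebra (FractionRing D) S) :=
  comap_mem_heightOneSpectrum_iff _ _ toFractionAlgebra_injective
    (fun _ => isUnit_toFractionAlgebra) exists_mul_toFractionAlgebra_eq hQ

lemma exists_eq_comap_toGroupAlgebra {Q : Ideal (AddMonoidAlgebra D S)}
    (hQ : Q ∈ heightOneSpectrum (AddMonoidAlgebra D S))
    (h : ∀ s, AddMonoidAlgebra.single s 1 ∉ Q) :
    ∃ Q' ∈ heightOneSpectrum (AddMonoidAlgebra D (GrothendieckAddGroup S)),
      Q = Q'.comap (toGroupAlgebra D S) :=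
  exists_eq_comap_of_mem_heightOneSpectrum _ _ toGroupAlgebra_injective
    (fun _ => isUnit_toGroupAlgebra) exists_mul_toGroupAlgebra_eq hQ
    (by rintro _ ⟨s, rfl⟩; exact h _)

lemma exists_eq_comap_toFractionAlgebra [IsDomain D] {Q : Ideal (AddMonoidAlgebra D S)}
    (hQ : Q ∈ heightOneSpectrum (AddMonoidAlgebra D S))
    (h : ∀ d, d ≠ 0 → AddMonoidAlgebra.single 0 d ∉ Q) :
    ∃ Q' ∈ heightOneSpectrum (AddMonoidAlgebra (FractionRing D) S),
      Q = Q'.comap (toFractionAlgebra D S) :=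
  exists_eq_comap_of_mem_heightOneSpectrum _ _ toFractionAlgebra_injective
    (fun _ => isUnit_toFractionAlgebra) exists_mul_toFractionAlgebra_eq hQ
    (by rintro _ ⟨d, hd, rfl⟩; exact h d (nonZeroDivisors.ne_zero hd))

variable [IsAddTorsionFree S]

/-- It is the kernel of the reduction to `(D/P)[S]`, which is a domain because `S` has unique sums.
-/
lemma isPrime_coeffIdeal {P : Ideal D} (hP : P.IsPrime) : (coeffIdeal S P).IsPrime := by
  rw [coeffIdeal_eq_ker]
  exact RingHom.ker_isPrime _

/-- Take a unique sum `s + t` of exponents of `f` and `g` outside `P`. As `s + t ∉ P`, no exponent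
in `P` can contribute to it, so its coefficient in `f * g` is a product of two non-zero
coefficients. -/
lemma isPrime_exponentIdeal [IsDomain D] {P : AddSemigroupIdeal S} (hP : IsPrimeIdeal P) :
    (exponentIdeal D P).IsPrime := by
  classical
  refine ⟨?_, fun {f g} hfg => ?_⟩
  · rw [Ideal.ne_top_iff_one, AddMonoidAlgebra.one_def, single_mem_exponentIdeal one_ne_zero]
    exact hP.zero_notMem
  · by_contra! hcon
    have key : ∀ f : AddMonoidAlgebra D S, f ∉ exponentIdeal D P →
        (f.coeff.support.filter (· ∉ P)).Nonempty := fun f hf => by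
      simp only [mem_exponentIdeal, not_forall] at hf
      obtain ⟨s, hs, hsP⟩ := hf
      exact ⟨s, by simp [hs, hsP]⟩
    obtain ⟨s, hs, t, ht, hst⟩ := UniqueSums.uniqueAdd_of_nonempty (key f hcon.1) (key g hcon.2)
    rw [Finset.mem_filter, Finsupp.mem_support_iff] at hs ht
    have hsP : s + t ∉ P := fun h => (hP.mem_or_mem h).elim hs.2 ht.2
    have huniq : UniqueAdd f.coeff.support g.coeff.support s t := fun a b ha hb hab => by
      refine hst (Finset.mem_filter.2 ⟨ha, fun h => ?_⟩) (Finset.mem_filter.2 ⟨hb, fun h => ?_⟩) hab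
      · exact hsP (by rw [← hab, add_comm]; exact AddSemigroupIdeal.add_mem P b h)
      · exact hsP (by rw [← hab]; exact AddSemigroupIdeal.add_mem P a h)
    refine hsP (hfg _ ?_)
    rw [AddMonoidAlgebra.coeff_mul_add_of_uniqueAdd huniq]
    exact mul_ne_zero hs.1 ht.1

variable [IsDomain D]

/-- A height-one prime of `D[S]` containing a monomial is of the form `D[P]`. -/
lemma exists_eq_exponentIdeal {Q : Ideal (AddMonoidAlgebra D S)}
    (hQ : Q ∈ heightOneSpectrum (AddMonoidAlgebra D S)) {s : S}
    (hs : AddMonoidAlgebra.single s 1 ∈ Q) :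
    ∃ P ∈ minimalPrimeIdeals S, Q = exponentIdeal D P := by
  obtain ⟨hQp, hQ0, hmin⟩ := mem_heightOneSpectrum_iff.1 hQ
  -- Every non-empty prime `P` of exponents of `Q` gives a non-zero prime `D[P]` inside `Q`, hence
  -- `Q` itself. This proves at once that `Q` has the right form and that its exponent ideal is
  -- minimal.
  have heq : ∀ P : AddSemigroupIdeal S, IsPrimeIdeal P → (P : Set S).Nonempty →
      P ≤ monomialExponents Q → exponentIdeal D P = Q := fun P hP hP0 hle =>
    hmin _ (isPrime_exponentIdeal hP) (exponentIdeal_ne_bot hP0) (exponentIdeal_le hle)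
  have h1 := isPrimeIdeal_monomialExponents hQp
  have h2 : (monomialExponents Q : Set S).Nonempty := ⟨s, hs⟩
  refine ⟨monomialExponents Q, ⟨⟨h1, h2⟩, fun P hP hle => ?_⟩, (heq _ h1 h2 le_rfl).symm⟩
  exact (exponentIdeal_injective (((heq _ h1 h2 le_rfl)).trans (heq P hP.1 hP.2 hle).symm)).le

/-- A height-one prime of `D[S]` containing a non-zero constant is of the form `P[S]`. -/
lemma exists_eq_coeffIdeal {Q : Ideal (AddMonoidAlgebra D S)}
    (hQ : Q ∈ heightOneSpectrum (AddMonoidAlgebra D S)) {d : D} (hd0 : d ≠ 0)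
    (hd : AddMonoidAlgebra.single 0 d ∈ Q) :
    ∃ P ∈ heightOneSpectrum D, Q = coeffIdeal S P := by
  obtain ⟨hQp, hQ0, hmin⟩ := mem_heightOneSpectrum_iff.1 hQ
  set P := Q.comap (AddMonoidAlgebra.singleZeroRingHom : D →+* AddMonoidAlgebra D S) with hPdef
  have heq : ∀ P' : Ideal D, P'.IsPrime → P' ≠ ⊥ → P' ≤ P → coeffIdeal S P' = Q :=
    fun P' hP hP0 hle => hmin _ (isPrime_coeffIdeal hP) (coeffIdeal_ne_bot hP0) (coeffIdeal_le hle)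
  have h1 : P.IsPrime := hQp.comap _
  have h2 : P ≠ ⊥ := fun h => hd0 (by
    have : d ∈ P := hd
    rwa [h, Ideal.mem_bot] at this)
  refine ⟨P, mem_heightOneSpectrum_iff.2 ⟨h1, h2, fun P' hP' hP0 hle => ?_⟩,
    (heq _ h1 h2 le_rfl).symm⟩
  exact coeffIdeal_injective ((heq P' hP' hP0 hle).trans (heq _ h1 h2 le_rfl).symm)

/-- The rest of the UMT equality is automatic: a height-one prime contains a monomial or survives in
`D[G]`, and contraction along a localization preserves height. -/
lemma isUMTMonoid_iff :
    IsUMTMonoid S D ↔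
      ∀ P ∈ minimalPrimeIdeals S, exponentIdeal D P ∈ heightOneSpectrum (AddMonoidAlgebra D S) := by
  constructor
  · intro h P hP
    rw [h]
    exact Or.inl ⟨P, hP, rfl⟩
  · refine fun h => Set.Subset.antisymm (fun Q hQ => ?_) ?_
    · by_cases hs : ∀ s, AddMonoidAlgebra.single s 1 ∉ Q
      · exact Or.inr (exists_eq_comap_toGroupAlgebra hQ hs)
      · push Not at hs
        exact Or.inl (exists_eq_exponentIdeal hQ hs.choose_spec)
    · rintro _ (⟨P, hP, rfl⟩ | ⟨Q, hQ, rfl⟩)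
      · exact h P hP
      · exact (comap_toGroupAlgebra_mem_iff hQ.1).2 hQ

lemma isUMTDomain_iff :
    IsUMTDomain D S ↔
      ∀ P ∈ heightOneSpectrum D, coeffIdeal S P ∈ heightOneSpectrum (AddMonoidAlgebra D S) := by
  constructor
  · intro h P hP
    rw [h]
    exact Or.inl ⟨P, hP, rfl⟩
  · refine fun h => Set.Subset.antisymm (fun Q hQ => ?_) ?_
    · by_cases hs : ∀ d, d ≠ 0 → AddMonoidAlgebra.single 0 d ∉ Q
      · exact Or.inr (exists_eq_comap_toFractionAlgebra hQ hs)
      · push Not at hs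
        obtain ⟨d, hd0, hd⟩ := hs
        exact Or.inl (exists_eq_coeffIdeal hQ hd0 hd)
    · rintro _ (⟨P, hP, rfl⟩ | ⟨Q, hQ, rfl⟩)
      · exact h P hP
      · exact (comap_toFractionAlgebra_mem_iff hQ.1).2 hQ

/-- `D[P]` is the contraction of `K[P]` along the localization `D[S] → K[S]`, so the two have equal
height. This moves the condition into the ring `D[S]` itself. -/
lemma isUMTMonoid_fractionRing_iff :
    IsUMTMonoid S (FractionRing D) ↔
      ∀ P ∈ minimalPrimeIdeals S, exponentIdeal D P ∈ heightOneSpectrum (AddMonoidAlgebra D S) := by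
  rw [isUMTMonoid_iff]
  refine forall₂_congr fun P hP => ?_
  rw [← comap_toFractionAlgebra_exponentIdeal (D := D),
    comap_toFractionAlgebra_mem_iff (isPrime_exponentIdeal hP.1.1)]

lemma isUMTDomain_grothendieckAddGroup_iff :
    IsUMTDomain D (GrothendieckAddGroup S) ↔
      ∀ P ∈ heightOneSpectrum D, coeffIdeal S P ∈ heightOneSpectrum (AddMonoidAlgebra D S) := by
  rw [isUMTDomain_iff]
  refine forall₂_congr fun P hP => ?_
  rw [← comap_toGroupAlgebra_coeffIdeal (S := S), comap_toGroupAlgebra_mem_iff (isPrime_coeffIdeal hP.1)]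

/-- The height-one primes of `D[S]` come from `D`, from `S` or from `K[G]`. -/
lemma mem_heightOneSpectrum_cases {Q : Ideal (AddMonoidAlgebra D S)}
    (hQ : Q ∈ heightOneSpectrum (AddMonoidAlgebra D S)) :
    (∃ P ∈ heightOneSpectrum D, Q = coeffIdeal S P) ∨
    (∃ P ∈ minimalPrimeIdeals S, Q = exponentIdeal D P) ∨
    ∃ Q' ∈ heightOneSpectrum (AddMonoidAlgebra (FractionRing D) (GrothendieckAddGroup S)),
      Q = Q'.comap ((toGroupAlgebra (FractionRing D) S).comp (toFractionAlgebra D S)) := by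
  by_cases hs : ∀ d, d ≠ 0 → AddMonoidAlgebra.single 0 d ∉ Q
  · obtain ⟨Q', hQ', rfl⟩ := exists_eq_comap_toFractionAlgebra hQ hs
    by_cases hs : ∀ s, AddMonoidAlgebra.single s 1 ∉ Q'
    · obtain ⟨Q'', hQ'', rfl⟩ := exists_eq_comap_toGroupAlgebra hQ' hs
      exact Or.inr (Or.inr ⟨Q'', hQ'', by rw [Ideal.comap_comap]⟩)
    · push Not at hs
      obtain ⟨s, hs⟩ := hs
      exact Or.inr (Or.inl (exists_eq_exponentIdeal hQ (s := s) (by simpa using hs)))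
  · push Not at hs
    obtain ⟨d, hd0, hd⟩ := hs
    exact Or.inl (exists_eq_coeffIdeal hQ hd0 hd)

end Primes

/-! ### Weakly Krull monoids -/

section WeaklyKrullMonoid

variable {S : Type*} [AddCancelCommMonoid S]

/-- The intersection condition, in terms of divisibility. -/
lemma isWeaklyKrullMonoid_iff :
    IsWeaklyKrullMonoid S ↔
      (∀ a b : S, (∀ P ∈ minimalPrimeIdeals S, ∃ d ∉ P, ∃ c, a + d = b + c) → ∃ c, a = b + c) ∧
      ∀ x : S, ¬ IsAddUnit x → {P ∈ minimalPrimeIdeals S | x ∈ P}.Finite := by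
  have key : ∀ (a b : S) (P : AddSemigroupIdeal S),
      (GrothendieckAddGroup.of a - GrothendieckAddGroup.of b : GrothendieckAddGroup S) ∈
        monoidLocalizationAt P ↔ ∃ d ∉ P, ∃ c, a + d = b + c := fun a b P => by
    constructor
    · rintro ⟨c, d, hd, h⟩
      exact ⟨d, hd, c, by rw [of_sub_of_eq_iff.1 h, add_comm]⟩
    · rintro ⟨d, hd, c, h⟩
      exact ⟨c, d, hd, of_sub_of_eq_iff.2 (by rw [h, add_comm])⟩
  have key' : ∀ a b : S,
      (GrothendieckAddGroup.of a - GrothendieckAddGroup.of b : GrothendieckAddGroup S) ∈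
        Set.range (GrothendieckAddGroup.of : S →+ GrothendieckAddGroup S) ↔ ∃ c, a = b + c :=
    fun a b => by
      refine exists_congr fun c => ?_
      rw [eq_sub_iff_add_eq, ← map_add, of_injective.eq_iff, add_comm, eq_comm]
  constructor
  · rintro ⟨h1, h2⟩
    refine ⟨fun a b h => ?_, h2⟩
    rw [← key', ← h1]
    exact Set.mem_iInter₂.2 fun P hP => (key a b P).2 (h P hP)
  · rintro ⟨h1, h2⟩
    refine ⟨Set.Subset.antisymm (fun g hg => ?_) ?_, h2⟩
    · obtain ⟨a, b, rfl⟩ := exists_eq_of_sub_of g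
      exact (key' a b).2 (h1 a b fun P hP => (key a b P).1 (Set.mem_iInter₂.1 hg P hP))
    · rintro _ ⟨c, rfl⟩
      refine Set.mem_iInter₂.2 fun P hP => ⟨c, 0, hP.1.1.zero_notMem, ?_⟩
      rw [map_zero, sub_zero]

end WeaklyKrullMonoid

/-! ### Faces and widths of elements of a group algebra -/

section Faces

variable {K G : Type*} [CommRing K] [AddCommGroup G]

/-- The least value of `χ` on the exponents of `f`. -/
noncomputable def minOn (χ : G →+ ℝ) (f : AddMonoidAlgebra K G) : ℝ :=
  if h : f.coeff.support.Nonempty then f.coeff.support.inf' h χ else 0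

/-- The part of `f` supported on the exponents at which `χ` is least. -/
noncomputable def face (χ : G →+ ℝ) (f : AddMonoidAlgebra K G) : AddMonoidAlgebra K G :=
  open Classical in .ofCoeff (f.coeff.filter fun a => χ a = minOn χ f)

/-- The difference of the largest and the least value of `χ` on the exponents of `f`. -/
noncomputable def width (χ : G →+ ℝ) (f : AddMonoidAlgebra K G) : ℝ :=
  -minOn (-χ) f - minOn χ f

lemma support_nonempty {f : AddMonoidAlgebra K G} (hf : f ≠ 0) : f.coeff.support.Nonempty := by
  rwa [Finsupp.support_nonempty_iff, Ne, AddMonoidAlgebra.coeff_eq_zero]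

variable {χ : G →+ ℝ} {f g : AddMonoidAlgebra K G}

lemma minOn_le {a : G} (ha : f.coeff a ≠ 0) : minOn χ f ≤ χ a := by
  have ha' : a ∈ f.coeff.support := Finsupp.mem_support_iff.2 ha
  rw [minOn, dif_pos ⟨a, ha'⟩]
  exact Finset.inf'_le _ ha'

lemma exists_eq_minOn (χ : G →+ ℝ) (hf : f ≠ 0) : ∃ a, f.coeff a ≠ 0 ∧ χ a = minOn χ f := by
  rw [minOn, dif_pos (support_nonempty hf)]
  obtain ⟨a, ha, h⟩ := Finset.exists_mem_eq_inf' (support_nonempty hf) χ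
  exact ⟨a, Finsupp.mem_support_iff.1 ha, h.symm⟩

lemma minOn_eq {a : G} (ha : f.coeff a ≠ 0) (h : ∀ b, f.coeff b ≠ 0 → χ a ≤ χ b) :
    minOn χ f = χ a := by
  have hf : f ≠ 0 := fun h => ha (by simp [h])
  obtain ⟨b, hb, hb'⟩ := exists_eq_minOn χ hf
  exact le_antisymm (minOn_le ha) (hb' ▸ h b hb)

lemma coeff_face_ne_zero_iff {a : G} :
    (face χ f).coeff a ≠ 0 ↔ f.coeff a ≠ 0 ∧ χ a = minOn χ f := by
  classical
  rw [face, AddMonoidAlgebra.coeff_ofCoeff, Finsupp.filter_apply]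
  split_ifs with h <;> simp [h]

lemma coeff_face_of_eq {a : G} (h : χ a = minOn χ f) : (face χ f).coeff a = f.coeff a := by
  classical
  rw [face, AddMonoidAlgebra.coeff_ofCoeff, Finsupp.filter_apply, if_pos h]

lemma face_ne_zero (hf : f ≠ 0) : face χ f ≠ 0 := by
  obtain ⟨a, ha⟩ := exists_eq_minOn χ hf
  exact fun h => coeff_face_ne_zero_iff.2 ha (by simp [h])

lemma exists_of_coeff_mul_ne_zero {x : G} (h : (f * g).coeff x ≠ 0) :
    ∃ a b, f.coeff a ≠ 0 ∧ g.coeff b ≠ 0 ∧ x = a + b := by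
  classical
  obtain ⟨a, ha, b, hb, hab⟩ := Finset.mem_add.1
    (AddMonoidAlgebra.support_coeff_mul_subset f g (Finsupp.mem_support_iff.2 h))
  exact ⟨a, b, Finsupp.mem_support_iff.1 ha, Finsupp.mem_support_iff.1 hb, hab.symm⟩

/-- At the lowest possible level only pairs of minimal exponents can contribute: a factor `g - face
χ g` has all its exponents strictly above the minimum. -/
lemma coeff_mul_eq_coeff_face_mul {x : G} (hx : χ x = minOn χ f + minOn χ g) :
    (f * g).coeff x = (face χ f * face χ g).coeff x := by
  have key : ∀ f g : AddMonoidAlgebra K G, χ x = minOn χ f + minOn χ g →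
      (f * (g - face χ g)).coeff x = 0 := fun f g hx => by
    by_contra h
    obtain ⟨a, b, ha, hb, rfl⟩ := exists_of_coeff_mul_ne_zero h
    rw [AddMonoidAlgebra.coeff_sub, Finsupp.sub_apply] at hb
    have hba : χ b ≠ minOn χ g := fun h => hb (by rw [coeff_face_of_eq h, sub_self])
    have hb' : g.coeff b ≠ 0 := fun h => hb (by
      rw [h, zero_sub, neg_eq_zero]
      by_contra h'
      exact (coeff_face_ne_zero_iff.1 h').1 h)
    have h1 := minOn_le (χ := χ) ha
    have h2 := lt_of_le_of_ne (minOn_le (χ := χ) hb') hba.symm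
    rw [map_add] at hx
    linarith
  have hface : f ≠ 0 → minOn χ (face χ f) = minOn χ f := fun hf => by
    obtain ⟨a, ha, ha'⟩ := exists_eq_minOn χ hf
    rw [← ha']
    refine minOn_eq (coeff_face_ne_zero_iff.2 ⟨ha, ha'⟩) fun b hb => ?_
    rw [(coeff_face_ne_zero_iff.1 hb).2, ha']
  rcases eq_or_ne f 0 with rfl | hf
  · have h0 : face χ (0 : AddMonoidAlgebra K G) = 0 := by
      ext a
      by_contra h
      exact (coeff_face_ne_zero_iff.1 h).1 rfl
    rw [h0, zero_mul, zero_mul]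
  have h1 := key g f (by rw [hx, add_comm])
  have h2 := key (face χ f) g (by rw [hface hf, hx])
  have : f * g = g * (f - face χ f) + face χ f * (g - face χ g) + face χ f * face χ g := by ring
  rw [this, AddMonoidAlgebra.coeff_add, AddMonoidAlgebra.coeff_add, Finsupp.add_apply,
    Finsupp.add_apply, h1, h2, zero_add, zero_add]

lemma sub_le_width {a b : G} (ha : f.coeff a ≠ 0) (hb : f.coeff b ≠ 0) :
    χ (b - a) ≤ width χ f := by
  have h1 := minOn_le (χ := χ) ha
  have h2 := minOn_le (χ := -χ) hb
  rw [AddMonoidHom.neg_apply] at h2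
  rw [width, map_sub]
  linarith

lemma width_nonneg (hf : f ≠ 0) : 0 ≤ width χ f := by
  obtain ⟨a, ha, -⟩ := exists_eq_minOn χ hf
  simpa using sub_le_width (χ := χ) ha ha

lemma exists_eq_width (χ : G →+ ℝ) (hf : f ≠ 0) :
    ∃ a b, f.coeff a ≠ 0 ∧ f.coeff b ≠ 0 ∧ χ (b - a) = width χ f := by
  obtain ⟨a, ha, ha'⟩ := exists_eq_minOn χ hf
  obtain ⟨b, hb, hb'⟩ := exists_eq_minOn (-χ) hf
  refine ⟨a, b, ha, hb, ?_⟩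
  rw [width, ← ha', ← hb', map_sub, AddMonoidHom.neg_apply, neg_neg]

variable [IsDomain K] [IsAddTorsionFree G]

/-- The product of the two faces is non-zero since `K[G]` is a domain, so the lowest possible level
is attained. -/
lemma minOn_mul (hf : f ≠ 0) (hg : g ≠ 0) : minOn χ (f * g) = minOn χ f + minOn χ g := by
  obtain ⟨x, hx⟩ := support_nonempty (mul_ne_zero (face_ne_zero (χ := χ) hf)
    (face_ne_zero (χ := χ) hg))
  have hx := Finsupp.mem_support_iff.1 hx
  obtain ⟨a, b, ha, hb, rfl⟩ := exists_of_coeff_mul_ne_zero hx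
  have hab : χ (a + b) = minOn χ f + minOn χ g := by
    rw [map_add, (coeff_face_ne_zero_iff.1 ha).2, (coeff_face_ne_zero_iff.1 hb).2]
  rw [← hab]
  refine minOn_eq (by rwa [coeff_mul_eq_coeff_face_mul hab]) fun y hy => ?_
  obtain ⟨c, d, hc, hd, rfl⟩ := exists_of_coeff_mul_ne_zero hy
  rw [hab, map_add]
  exact add_le_add (minOn_le hc) (minOn_le hd)

lemma face_mul (hf : f ≠ 0) (hg : g ≠ 0) : face χ (f * g) = face χ f * face χ g := by
  ext x
  by_cases hx : χ x = minOn χ (f * g)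
  · rw [coeff_face_of_eq hx, coeff_mul_eq_coeff_face_mul (by rw [hx, minOn_mul hf hg])]
  · have h1 : (face χ (f * g)).coeff x = 0 := by
      by_contra h
      exact hx (coeff_face_ne_zero_iff.1 h).2
    have h2 : (face χ f * face χ g).coeff x = 0 := by
      by_contra h
      obtain ⟨a, b, ha, hb, rfl⟩ := exists_of_coeff_mul_ne_zero h
      rw [minOn_mul hf hg, map_add, (coeff_face_ne_zero_iff.1 ha).2,
        (coeff_face_ne_zero_iff.1 hb).2] at hx
      exact hx rfl
    rw [h1, h2]

lemma width_mul (hf : f ≠ 0) (hg : g ≠ 0) : width χ (f * g) = width χ f + width χ g := by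
  rw [width, width, width, minOn_mul hf hg, minOn_mul hf hg]
  ring

lemma face_prod {ι : Type*} (s : Finset ι) {c : ι → AddMonoidAlgebra K G} (hc : ∀ i ∈ s, c i ≠ 0)
    (hf : f ≠ 0) : face χ (f * ∏ i ∈ s, c i) = face χ f * ∏ i ∈ s, face χ (c i) := by
  classical
  induction s using Finset.induction_on with
  | empty => simp
  | insert i s hi ih =>
    have hs : ∀ j ∈ s, c j ≠ 0 := fun j hj => hc j (Finset.mem_insert_of_mem hj)
    rw [Finset.prod_insert hi, Finset.prod_insert hi, mul_left_comm, face_mul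
      (hc i (Finset.mem_insert_self _ _)) (mul_ne_zero hf (Finset.prod_ne_zero_iff.2 hs)), ih hs,
      mul_left_comm]

lemma width_prod {ι : Type*} (s : Finset ι) {c : ι → AddMonoidAlgebra K G} (hc : ∀ i ∈ s, c i ≠ 0)
    (hf : f ≠ 0) : width χ (f * ∏ i ∈ s, c i) = width χ f + ∑ i ∈ s, width χ (c i) := by
  classical
  induction s using Finset.induction_on with
  | empty => simp
  | insert i s hi ih =>
    have hs : ∀ j ∈ s, c j ≠ 0 := fun j hj => hc j (Finset.mem_insert_of_mem hj)
    rw [Finset.prod_insert hi, Finset.sum_insert hi, mul_left_comm, width_mul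
      (hc i (Finset.mem_insert_self _ _)) (mul_ne_zero hf (Finset.prod_ne_zero_iff.2 hs)), ih hs,
      add_left_comm]

end Faces

/-! ### Pure closures of cyclic subgroups -/

section CyclicSubgroups

variable {G : Type*} [AddCommGroup G] [IsAddTorsionFree G]

/-- Under the ascending chain condition on cyclic subgroups, the pure closure of a cyclic subgroup
is cyclic. -/
lemma ACCOnCyclicSubgroups.exists_generator (hG : ACCOnCyclicSubgroups G) (v : G) :
    ∃ w : G, (∃ n : ℤ, v = n • w) ∧
      ∀ x, ∀ m n : ℤ, m ≠ 0 → m • x = n • v → ∃ k : ℤ, x = k • w := by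
  have : WellFoundedGT {H : AddSubgroup G // ∃ g : G, H = AddSubgroup.zmultiples g} := hG
  -- `w` generates a maximal cyclic subgroup among those containing `v`.
  obtain ⟨⟨_, w, rfl⟩, hw, hmax⟩ := WellFounded.has_min
    (wellFounded_gt (α := {H : AddSubgroup G // ∃ g : G, H = AddSubgroup.zmultiples g}))
    {H | v ∈ H.1} ⟨⟨_, v, rfl⟩, AddSubgroup.mem_zmultiples v⟩
  obtain ⟨n, hn⟩ := AddSubgroup.mem_zmultiples_iff.1 hw
  refine ⟨w, ⟨n, hn.symm⟩, fun x m k hm hx => ?_⟩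
  rw [← hn, ← mul_smul] at hx
  obtain ⟨g, m', l, hg0, hcop, hm', hl⟩ : ∃ g m' l : ℤ, g ≠ 0 ∧ IsCoprime m' l ∧
      m = g * m' ∧ k * n = g * l := by
    have hg : 0 < Int.gcd m (k * n) := Int.gcd_pos_of_ne_zero_left _ hm
    refine ⟨Int.gcd m (k * n), m / Int.gcd m (k * n), k * n / Int.gcd m (k * n),
      by exact_mod_cast hg.ne', ?_, (Int.mul_ediv_cancel' (Int.gcd_dvd_left ..)).symm,
      (Int.mul_ediv_cancel' (Int.gcd_dvd_right ..)).symm⟩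
    rw [Int.isCoprime_iff_gcd_eq_one]
    exact Int.gcd_ediv_gcd_ediv_gcd hg
  have hx' : m' • x = l • w := by
    rw [hm', hl, mul_smul, mul_smul] at hx
    exact zsmul_right_injective hg0 hx
  -- By Bézout, `a • w + b • x` generates both `w` and `x`; maximality puts it back into the
  -- subgroup of `w`.
  obtain ⟨a, b, hab⟩ := hcop
  have h1 : m' • (a • w + b • x) = w := by
    calc m' • (a • w + b • x) = (a * m') • w + b • (m' • x) := by module
      _ = (a * m' + b * l) • w := by rw [hx']; module
      _ = w := by rw [hab, one_smul]
  have h2 : l • (a • w + b • x) = x := by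
    calc l • (a • w + b • x) = a • (l • w) + (b * l) • x := by module
      _ = (a * m' + b * l) • x := by rw [← hx']; module
      _ = x := by rw [hab, one_smul]
  have hle : AddSubgroup.zmultiples w ≤ AddSubgroup.zmultiples (a • w + b • x) := by
    rw [AddSubgroup.zmultiples_le]
    exact AddSubgroup.mem_zmultiples_iff.2 ⟨m', h1⟩
  have hnlt := hmax ⟨_, a • w + b • x, rfl⟩ (hle hw)
  have hxm : x ∈ AddSubgroup.zmultiples (a • w + b • x) := AddSubgroup.mem_zmultiples_iff.2 ⟨l, h2⟩
  have hge : AddSubgroup.zmultiples (a • w + b • x) ≤ AddSubgroup.zmultiples w := by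
    by_contra hcon
    exact hnlt (lt_of_le_not_ge hle hcon)
  obtain ⟨k, hk⟩ := AddSubgroup.mem_zmultiples_iff.1 (hge hxm)
  exact ⟨k, hk.symm⟩

end CyclicSubgroups

/-! ### Generic pairs of real functionals -/

section GenericFunctionals

open Polynomial

/-- On a finite-dimensional rational space there are two real functionals, the first of them
injective, that map linearly independent pairs to linearly independent pairs. -/
lemma exists_independent_functionals (n : ℕ) :
    ∃ φ ψ : (Fin n → ℚ) →+ ℝ, (∀ x, φ x = 0 → x = 0) ∧
      ∀ x y, φ x * ψ y = φ y * ψ x → ∀ i j, x i * y j = y i * x j := by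
  -- The functionals are `∑ xᵢ αⁱ` and `∑ xᵢ αⁿⁱ` for a transcendental `α`, so identities between
  -- their values are identities of polynomials.
  have hα : Transcendental ℚ (liouvilleNumber 2) := fun h =>
    transcendental_liouvilleNumber (m := 2) le_rfl ((IsFractionRing.isAlgebraic_iff ℤ ℚ ℝ).2 h)
  have hinj := transcendental_iff_injective.1 hα
  let P : (Fin n → ℚ) →+ ℚ[X] :=
    { toFun := fun x => ∑ i : Fin n, monomial (i : ℕ) (x i)
      map_zero' := by simp
      map_add' := fun x y => by simp [Finset.sum_add_distrib] }
  let Q : (Fin n → ℚ) →+ ℚ[X] :=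
    { toFun := fun x => ∑ i : Fin n, monomial (n * (i : ℕ)) (x i)
      map_zero' := by simp
      map_add' := fun x y => by simp [Finset.sum_add_distrib] }
  have hP : ∀ x (i : Fin n), (P x).coeff (i : ℕ) = x i := fun x i => by
    simp only [P, AddMonoidHom.coe_mk, ZeroHom.coe_mk, finsetSum_coeff, coeff_monomial]
    simp [Fin.val_inj]
  -- The exponents `j + n * i` with `i, j < n` are distinct, so each product `x j * y i` can be read
  -- off separately.
  have hPQ : ∀ x y i j, (P x * Q y).coeff ((finProdFinEquiv (i, j) : Fin (n * n)) : ℕ) =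
      x j * y i := fun x y i j => by
    have : P x * Q y = ∑ p : Fin n × Fin n,
        monomial ((finProdFinEquiv p : Fin (n * n)) : ℕ) (x p.2 * y p.1) := by
      rw [Fintype.sum_prod_type, Finset.sum_comm]
      simp only [P, Q, AddMonoidHom.coe_mk, ZeroHom.coe_mk, Finset.sum_mul_sum, monomial_mul_monomial]
      rfl
    rw [this]
    simp only [finsetSum_coeff, coeff_monomial]
    simp only [Fin.val_inj, EmbeddingLike.apply_eq_iff_eq]
    rw [Finset.sum_ite_eq' Finset.univ (i, j), if_pos (Finset.mem_univ _)]
  refine ⟨(aeval (liouvilleNumber 2 : ℝ)).toRingHom.toAddMonoidHom.comp P,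
    (aeval (liouvilleNumber 2 : ℝ)).toRingHom.toAddMonoidHom.comp Q, fun x hx => ?_,
    fun x y hxy i j => ?_⟩
  · have : P x = 0 := hinj (by simpa using hx)
    ext i
    rw [Pi.zero_apply, ← hP x i, this, coeff_zero]
  · have : P x * Q y = P y * Q x := hinj (by simpa using hxy)
    rw [← hPQ x y j i, this, hPQ]

variable {G : Type*} [AddCommGroup G] [IsAddTorsionFree G]

/-- `H` is the part of `G` in the rational span of `T`, where coordinates make the previous
functionals available. Thus elements of `H` with parallel images in the plane are already
commensurable in `G`. -/
lemma exists_generic_functionals (T : Set G) (hT : T.Finite) :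
    ∃ φ ψ : G →+ ℝ, ∃ H : AddSubgroup G, T ⊆ H ∧ (∀ x ∈ H, φ x = 0 → x = 0) ∧
      ∀ x ∈ H, ∀ y ∈ H, y ≠ 0 → φ x * ψ y = φ y * ψ x → ∃ m n : ℤ, m ≠ 0 ∧ m • x = n • y := by
  let ι : G →+ DivisibleHull G := DivisibleHull.coeAddMonoidHom G
  have hι : Function.Injective ι := DivisibleHull.coe_injective
  let W : Submodule ℚ (DivisibleHull G) := Submodule.span ℚ (ι '' T)
  have : FiniteDimensional ℚ W := FiniteDimensional.span_of_finite ℚ (hT.image ι)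
  -- A projection onto `W` extends the functionals to all of `G`; they are generic only on `H`.
  obtain ⟨p, hp⟩ := W.subtype.exists_leftInverse_of_injective (Submodule.ker_subtype W)
  let b := Module.finBasis ℚ W
  let q : G →+ (Fin (Module.finrank ℚ W) → ℚ) :=
    ((b.equivFun : W →ₗ[ℚ] _).comp p).toAddMonoidHom.comp ι
  let H : AddSubgroup G := W.toAddSubgroup.comap ι
  have hq : ∀ x ∈ H, q x = 0 → x = 0 := fun x hx h => by
    have h1 : p (ι x) = 0 := by simpa [q] using h
    have h2 : p (ι x) = ⟨ι x, hx⟩ := LinearMap.congr_fun hp ⟨ι x, hx⟩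
    rw [h2] at h1
    have h3 : ι x = 0 := congrArg Subtype.val h1
    exact hι (h3.trans (map_zero ι).symm)
  obtain ⟨φ, ψ, hφ, hφψ⟩ := exists_independent_functionals (Module.finrank ℚ W)
  refine ⟨φ.comp q, ψ.comp q, H, fun x hx => Submodule.subset_span ⟨x, hx, rfl⟩,
    fun x hx h => hq x hx (hφ _ h), fun x hx y hy hy0 h => ?_⟩
  have hxy := hφψ (q x) (q y) h
  obtain ⟨j, hj⟩ : ∃ j, q y j ≠ 0 := by
    by_contra! hcon
    exact hy0 (hq y hy (funext hcon))
  set c : ℚ := q x j / q y j with hc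
  refine ⟨c.den, c.num, by exact_mod_cast c.den_ne_zero, ?_⟩
  rw [← sub_eq_zero]
  refine hq _ (H.sub_mem (H.zsmul_mem hx _) (H.zsmul_mem hy _)) ?_
  ext i
  have h1 : q x i = c * q y i := by
    rw [hc, div_mul_eq_mul_div, eq_div_iff hj, hxy i j, mul_comm]
  have h2 : (c.den : ℚ) * c = c.num := Rat.den_mul_eq_num c
  simp only [map_sub, map_zsmul, Pi.sub_apply, Pi.smul_apply, Pi.zero_apply, h1]
  rw [zsmul_eq_mul, zsmul_eq_mul, Int.cast_natCast]
  rw [← mul_assoc, h2, sub_self]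

end GenericFunctionals

/-! ### Bounding the number of non-monomial factors -/

section FactorBound

variable {K G : Type*} [CommRing K] [AddCommGroup G]

/-- The functional `x ↦ det ((φ v, ψ v), (φ x, ψ x))`, which vanishes at `v`. -/
noncomputable def detFunctional (φ ψ : G →+ ℝ) (v : G) : G →+ ℝ :=
  (AddMonoidHom.mulLeft (φ v)).comp ψ - (AddMonoidHom.mulLeft (ψ v)).comp φ

lemma detFunctional_apply (φ ψ : G →+ ℝ) (v x : G) :
    detFunctional φ ψ v x = φ v * ψ x - ψ v * φ x := rfl

/-- An element that is not a monomial has an edge: two exponents that both minimize the functional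
vanishing on their difference. -/
lemma exists_edge {φ ψ : G →+ ℝ} {H : AddSubgroup G} (hφ : ∀ x ∈ H, φ x = 0 → x = 0)
    {c : AddMonoidAlgebra K G} (hcH : ∀ x, c.coeff x ≠ 0 → x ∈ H)
    (hc : c.coeff.support.Nontrivial) :
    ∃ a b, c.coeff a ≠ 0 ∧ c.coeff b ≠ 0 ∧ 0 < φ (b - a) ∧
      detFunctional φ ψ (b - a) a = minOn (detFunctional φ ψ (b - a)) c ∧
      detFunctional φ ψ (b - a) b = minOn (detFunctional φ ψ (b - a)) c := by
  classical
  -- In the plane with coordinates `(φ, ψ)`, `a` is the leftmost exponent and `b` has the least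
  -- slope as seen from `a`, so all exponents lie on or above the line through `a` and `b`.
  obtain ⟨a, ha, hamin⟩ := c.coeff.support.exists_min_image φ hc.nonempty
  obtain ⟨b, hb, hbmin⟩ := (c.coeff.support.erase a).exists_min_image
    (fun x => ψ (x - a) / φ (x - a)) ((Finset.erase_nonempty ha).2 hc)
  have hpos : ∀ x ∈ c.coeff.support.erase a, 0 < φ (x - a) := fun x hx => by
    obtain ⟨hxa, hx⟩ := Finset.mem_erase.1 hx
    refine lt_of_le_of_ne (by rw [map_sub, sub_nonneg]; exact hamin x hx) fun h => hxa ?_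
    exact sub_eq_zero.1 (hφ _ (H.sub_mem (hcH x (Finsupp.mem_support_iff.1 hx))
      (hcH a (Finsupp.mem_support_iff.1 ha))) h.symm)
  have hle : ∀ x, c.coeff x ≠ 0 →
      detFunctional φ ψ (b - a) a ≤ detFunctional φ ψ (b - a) x := fun x hx => by
    rcases eq_or_ne x a with rfl | hxa
    · exact le_rfl
    have hx' : x ∈ c.coeff.support.erase a :=
      Finset.mem_erase.2 ⟨hxa, Finsupp.mem_support_iff.2 hx⟩
    have h1 := hbmin x hx'
    rw [div_le_div_iff₀ (hpos b hb) (hpos x hx')] at h1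
    rw [← sub_nonneg, ← map_sub, detFunctional_apply, sub_nonneg, mul_comm (φ _)]
    exact h1
  have ha' := Finsupp.mem_support_iff.1 ha
  have heq : detFunctional φ ψ (b - a) b = detFunctional φ ψ (b - a) a := by
    rw [← sub_eq_zero, ← map_sub, detFunctional_apply]
    ring
  have hmin := minOn_eq ha' hle
  exact ⟨a, b, ha', Finsupp.mem_support_iff.1 (Finset.mem_of_mem_erase hb), hpos b hb, hmin.symm,
    heq.trans hmin.symm⟩

lemma minOn_smul {χ χ' : G →+ ℝ} {l : ℝ} (hl : 0 < l) (h : ∀ x, χ' x = l * χ x)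
    {f : AddMonoidAlgebra K G} (hf : f ≠ 0) : minOn χ' f = l * minOn χ f := by
  obtain ⟨a, ha, ha'⟩ := exists_eq_minOn χ hf
  rw [← ha', ← h]
  refine minOn_eq ha fun b hb => ?_
  rw [h, h, ha']
  exact mul_le_mul_of_nonneg_left (minOn_le hb) hl.le

variable [IsDomain K] [IsAddTorsionFree G]

/-- A bound for the number of factors that are not monomials. -/
lemma card_le_of_eq_mul_prod {φ ψ : G →+ ℝ} {H : AddSubgroup G} (hφ : ∀ x ∈ H, φ x = 0 → x = 0)
    (hφψ : ∀ x ∈ H, ∀ y ∈ H, y ≠ 0 → φ x * ψ y = φ y * ψ x → ∃ m n : ℤ, m ≠ 0 ∧ m • x = n • y)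
    {ι : Type*} (I : Finset ι) {f h : AddMonoidAlgebra K G} {c : ι → AddMonoidAlgebra K G}
    (hf : f ≠ 0) (hfc : f = h * ∏ i ∈ I, c i) (hfH : ∀ x, f.coeff x ≠ 0 → x ∈ H)
    (hcH : ∀ i ∈ I, ∀ x, (c i).coeff x ≠ 0 → x ∈ H)
    (hc : ∀ i ∈ I, (c i).coeff.support.Nontrivial) {N : ℕ}
    (hN : ∀ s t, f.coeff s ≠ 0 → f.coeff t ≠ 0 → s ≠ t → ∃ w : G, ∃ n : ℤ, t - s = n • w ∧
      n.natAbs ≤ N ∧ ∀ x, ∀ m k : ℤ, m ≠ 0 → m • x = k • (t - s) → ∃ j : ℤ, x = j • w) :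
    I.card ≤ N * (f.coeff.support ×ˢ f.coeff.support).card := by
  classical
  have hh : h ≠ 0 := fun h0 => hf (by rw [hfc, h0, zero_mul])
  have hc0 : ∀ i ∈ I, c i ≠ 0 := fun i hi h0 => by
    have := hc i hi
    rw [h0] at this
    exact Finset.not_nontrivial_empty this
  -- An edge `a, b` of `c i` forces a parallel edge of `f`, because the face of `f` is the product
  -- of the faces of its factors and widths add up. The pair `p` records the ends of that edge of
  -- `f`.
  have hedge : ∀ i ∈ I, ∃ p : G × G, (f.coeff p.1 ≠ 0 ∧ f.coeff p.2 ≠ 0 ∧ p.1 ≠ p.2 ∧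
      φ (p.2 - p.1) = width φ (face (detFunctional φ ψ (p.2 - p.1)) f)) ∧
      ∃ a b, 0 < φ (b - a) ∧ b - a ∈ H ∧ detFunctional φ ψ (p.2 - p.1) (b - a) = 0 ∧
        (face (detFunctional φ ψ (p.2 - p.1)) (c i)).coeff a ≠ 0 ∧
        (face (detFunctional φ ψ (p.2 - p.1)) (c i)).coeff b ≠ 0 := by
    intro i hi
    obtain ⟨a, b, ha, hb, hab, ha', hb'⟩ := exists_edge (ψ := ψ) hφ (hcH i hi) (hc i hi)
    set δ := detFunctional φ ψ (b - a) with hδ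
    obtain ⟨s, t, hs, ht, hst⟩ := exists_eq_width φ (face_ne_zero (χ := δ) hf)
    have hpos : 0 < φ (t - s) := by
      rw [hst, hfc, face_prod I hc0 hh, width_prod I (fun i hi => face_ne_zero (hc0 i hi))
        (face_ne_zero hh)]
      refine add_pos_of_nonneg_of_pos (width_nonneg (face_ne_zero hh))
        (Finset.sum_pos' (fun j hj => width_nonneg (face_ne_zero (hc0 j hj))) ⟨i, hi, ?_⟩)
      exact hab.trans_le (sub_le_width (coeff_face_ne_zero_iff.2 ⟨ha, ha'⟩)
        (coeff_face_ne_zero_iff.2 ⟨hb, hb'⟩))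
    obtain ⟨hs, hs'⟩ := coeff_face_ne_zero_iff.1 hs
    obtain ⟨ht, ht'⟩ := coeff_face_ne_zero_iff.1 ht
    have h0 : φ (b - a) * ψ (t - s) = ψ (b - a) * φ (t - s) := by
      rw [← sub_eq_zero, ← detFunctional_apply, map_sub, ← hδ, hs', ht', sub_self]
    -- The two directions differ by a positive factor, so they cut out the same faces. Hence `p`
    -- alone determines the face, whichever `i` it came from.
    set l := φ (t - s) / φ (b - a) with hl
    have hl0 : 0 < l := div_pos hpos hab
    have hsmul : ∀ x, detFunctional φ ψ (t - s) x = l * δ x := fun x => by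
      have h1 : φ (t - s) = l * φ (b - a) := by rw [hl, div_mul_cancel₀ _ hab.ne']
      have h2 : ψ (t - s) = l * ψ (b - a) := by
        rw [hl, div_mul_eq_mul_div, eq_div_iff hab.ne', mul_comm, h0, mul_comm]
      rw [hδ, detFunctional_apply, detFunctional_apply, h1, h2]
      ring
    have hface : ∀ g : AddMonoidAlgebra K G, g ≠ 0 →
        face (detFunctional φ ψ (t - s)) g = face δ g := fun g hg => by
      have : ∀ x, detFunctional φ ψ (t - s) x = minOn (detFunctional φ ψ (t - s)) g ↔
          δ x = minOn δ g := fun x => by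
        rw [minOn_smul hl0 hsmul hg, hsmul, mul_right_inj' hl0.ne']
      simp only [face, this]
    refine ⟨(s, t), ⟨hs, ht, ?_, ?_⟩, a, b, hab, H.sub_mem (hcH i hi b hb) (hcH i hi a ha), ?_, ?_⟩
    · intro h
      rw [show s = t from h, sub_self, map_zero] at hpos
      exact lt_irrefl _ hpos
    · rw [hface f hf, hst]
    · rw [hsmul, map_sub, ha', hb', sub_self, mul_zero]
    · rw [hface _ (hc0 i hi)]
      exact ⟨coeff_face_ne_zero_iff.2 ⟨ha, ha'⟩, coeff_face_ne_zero_iff.2 ⟨hb, hb'⟩⟩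
  have hne : Nonempty (G × G) := ⟨0⟩
  choose! p hp a b hab habH hdet ha hb using hedge
  -- It remains to see that at most `N` factors share one edge of `f`.
  refine Finset.card_le_mul_card_image_of_maps_to (f := p) (fun i hi => Finset.mem_product.2
    ⟨Finsupp.mem_support_iff.2 (hp i hi).1, Finsupp.mem_support_iff.2 (hp i hi).2.1⟩) N ?_
  intro q _
  rcases (I.filter fun i => p i = q).eq_empty_or_nonempty with hempty | ⟨i₀, hi₀⟩
  · rw [hempty]
    exact Nat.zero_le _
  obtain ⟨hi₀I, rfl⟩ := Finset.mem_filter.1 hi₀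
  obtain ⟨hs, ht, hst, hw⟩ := hp i₀ hi₀I
  set s := (p i₀).1 with hs_def
  set t := (p i₀).2 with ht_def
  set δ := detFunctional φ ψ (t - s) with hδ
  obtain ⟨w, n, hn, hnN, hgen⟩ := hN s t hs ht hst
  have hts0 : t - s ≠ 0 := sub_ne_zero.2 hst.symm
  have hw0 : φ w ≠ 0 := fun h0 => hts0 (hφ _ (H.sub_mem (hfH t ht) (hfH s hs)) (by
    rw [hn, map_zsmul, h0, smul_zero]))
  -- The edge of `c i` is parallel to `t - s`, hence a non-zero integer multiple of `w`. So each
  -- such factor uses at least `|φ w|` of the total width, which is at most `n.natAbs * |φ w|`.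
  have hJ : ∀ i ∈ I.filter (fun i => p i = p i₀), |φ w| ≤ width φ (face δ (c i)) := by
    intro i hi
    obtain ⟨hi, hpi⟩ := Finset.mem_filter.1 hi
    have ha' := ha i hi
    have hb' := hb i hi
    have hd' := hdet i hi
    rw [hpi] at ha' hb' hd'
    refine le_trans ?_ (sub_le_width ha' hb')
    obtain ⟨m, k, hm, hmk⟩ := hφψ _ (habH i hi) _ (H.sub_mem (hfH t ht) (hfH s hs)) hts0 (by
      have := sub_eq_zero.1 ((detFunctional_apply φ ψ _ _).symm.trans hd')
      rw [this, mul_comm])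
    obtain ⟨j, hj⟩ := hgen _ m k hm hmk
    have hpos := hab i hi
    rw [hj, map_zsmul, zsmul_eq_mul] at hpos ⊢
    have hj0 : j ≠ 0 := by
      rintro rfl
      simp at hpos
    rw [← abs_of_pos hpos, abs_mul]
    refine le_mul_of_one_le_left (abs_nonneg _) ?_
    exact_mod_cast Int.one_le_abs hj0
  have hsum : ((I.filter fun i => p i = p i₀).card : ℝ) * |φ w| ≤ φ (t - s) := by
    rw [hw, hfc, face_prod I hc0 hh, width_prod I (fun i hi => face_ne_zero (hc0 i hi))
        (face_ne_zero hh), ← nsmul_eq_mul]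
    refine (Finset.card_nsmul_le_sum _ _ _ hJ).trans ((Finset.sum_le_sum_of_subset_of_nonneg
      (Finset.filter_subset _ _) fun i hi _ => width_nonneg (face_ne_zero (hc0 i hi))).trans ?_)
    exact le_add_of_nonneg_left (width_nonneg (face_ne_zero hh))
  have h1 : φ (t - s) ≤ n.natAbs * |φ w| := by
    rw [hn, map_zsmul, zsmul_eq_mul, Nat.cast_natAbs, Int.cast_abs, ← abs_mul]
    exact le_abs_self _
  have h2 := le_of_mul_le_mul_right (hsum.trans h1) (abs_pos.2 hw0)
  exact (by exact_mod_cast h2 : (I.filter fun i => p i = p i₀).card ≤ n.natAbs).trans hnN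

end FactorBound

/-! ### Termination of divisor chains in `K[G]` -/

section WfDvd

variable {K G : Type*} [Field K] [AddCommGroup G]

lemma support_nontrivial_of_not_isUnit {c : AddMonoidAlgebra K G} (hc0 : c ≠ 0)
    (hc : ¬ IsUnit c) : c.coeff.support.Nontrivial := by
  rw [← Finset.one_lt_card_iff_nontrivial]
  by_contra! hcard
  have h1 : c.coeff.support.card = 1 :=
    le_antisymm hcard (Finset.card_pos.2 (support_nonempty hc0))
  obtain ⟨a, r, hr, h⟩ := Finsupp.card_support_eq_one'.1 h1
  refine hc (IsUnit.of_mul_eq_one (AddMonoidAlgebra.single (-a) r⁻¹) ?_)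
  have : c = AddMonoidAlgebra.single a r := AddMonoidAlgebra.coeff_injective h
  rw [this, AddMonoidAlgebra.single_mul_single, add_neg_cancel, mul_inv_cancel₀ hr,
    AddMonoidAlgebra.one_def]

/-- An infinite chain of proper divisors would write one element with arbitrarily many non-unit
factors. Over a field these are not monomials, so `card_le_of_eq_mul_prod` bounds their number. -/
lemma ACCOnCyclicSubgroups.wfDvdMonoid [IsAddTorsionFree G] (hG : ACCOnCyclicSubgroups G) :
    WfDvdMonoid (AddMonoidAlgebra K G) := by
  classical
  refine ⟨wellFounded_iff_isEmpty_descending_chain.2 ⟨fun ⟨u, hu⟩ => ?_⟩⟩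
  choose hu0 c hc huc using hu
  -- The chain is read from `u 1` on, since `u 0` may be zero.
  have hc0 : ∀ i, c (i + 1) ≠ 0 := fun i h => hu0 i (by rw [huc (i + 1), h, mul_zero])
  have hprod : ∀ n, u 1 = u (n + 1) * ∏ i ∈ Finset.range n, c (i + 1) := fun n => by
    induction n with
    | zero => simp
    | succ n ih => rw [ih, Finset.prod_range_succ, huc (n + 1)]; ring
  set f := u 1 with hfdef
  choose w hw hgen using fun p : G × G => hG.exists_generator (p.2 - p.1)
  choose n hn using hw
  set P := f.coeff.support ×ˢ f.coeff.support with hP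
  set N := ∑ p ∈ P, (n p).natAbs with hNdef
  set L := N * P.card + 1 with hL
  -- The bound depends on `f` alone, so the functionals may be chosen afterwards, generic for `f`
  -- and for `L` factors, one more than the bound allows.
  let T : Set G := (f.coeff.support ∪
    (Finset.range L).biUnion fun i => (c (i + 1)).coeff.support : Finset G)
  obtain ⟨φ, ψ, H, hTH, hφ, hφψ⟩ := exists_generic_functionals T (Finset.finite_toSet _)
  have : (Finset.range L).card ≤ N * P.card := card_le_of_eq_mul_prod hφ hφψ (Finset.range L) (N := N) (hu0 0) (hprod L)
    (fun x hx => hTH (Finset.mem_coe.2 (Finset.mem_union_left _ (Finsupp.mem_support_iff.2 hx))))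
    (fun i hi x hx => hTH (Finset.mem_coe.2 (Finset.mem_union_right _
      (Finset.mem_biUnion.2 ⟨i, hi, Finsupp.mem_support_iff.2 hx⟩))))
    (fun i _ => support_nontrivial_of_not_isUnit (hc0 i) (hc (i + 1)))
    (fun s t hs ht _ => ⟨w (s, t), n (s, t), hn (s, t),
      Finset.single_le_sum (f := fun p => (n p).natAbs) (fun _ _ => Nat.zero_le _)
        (Finset.mem_product.2 ⟨Finsupp.mem_support_iff.2 hs, Finsupp.mem_support_iff.2 ht⟩),
      hgen (s, t)⟩)
  rw [Finset.card_range] at this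
  omega

end WfDvd

/-! ### Primality of the elements of `K[G]` -/

section Decomposition

variable {K A G : Type*} [Field K] [AddCommMonoid A] [AddCommGroup G]

/-- Elements of `K[G]` with exponents in the difference group of the image of `θ` become elements
of `K[A]` after multiplication by a monomial. -/
lemma exists_mul_single_eq_mapDomainRingHom (θ : A →+ G) {H : Set G}
    (hH : ∀ x ∈ H, ∃ a b, x = θ a - θ b) {u : AddMonoidAlgebra K G}
    (hu : ∀ x, u.coeff x ≠ 0 → x ∈ H) :
    ∃ (m : A) (f : AddMonoidAlgebra K A),
      u * AddMonoidAlgebra.single (θ m) 1 = AddMonoidAlgebra.mapDomainRingHom K θ f := by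
  let N : AddSubmonoid (AddMonoidAlgebra K G) :=
    { carrier := {u | ∃ (m : A) (f : AddMonoidAlgebra K A),
        u * AddMonoidAlgebra.single (θ m) 1 = AddMonoidAlgebra.mapDomainRingHom K θ f}
      zero_mem' := ⟨0, 0, by simp⟩
      add_mem' := by
        rintro u v ⟨s, f, hf⟩ ⟨t, g, hg⟩
        refine ⟨s + t, f * AddMonoidAlgebra.single t 1 + g * AddMonoidAlgebra.single s 1, ?_⟩
        have hs : ∀ s : A, AddMonoidAlgebra.mapDomainRingHom K θ (AddMonoidAlgebra.single s 1) =
          AddMonoidAlgebra.single (θ s) 1 := fun s => AddMonoidAlgebra.mapDomain_single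
        have hst : AddMonoidAlgebra.single (θ (s + t)) (1 : K) =
            AddMonoidAlgebra.single (θ s) 1 * AddMonoidAlgebra.single (θ t) 1 := by
          rw [AddMonoidAlgebra.single_mul_single, map_add, mul_one]
        rw [hst, map_add, map_mul, map_mul, ← hf, ← hg, hs, hs]
        ring }
  change u ∈ N
  rw [← AddMonoidAlgebra.sum_coeff_single u]
  refine N.sum_mem fun x hx => ?_
  obtain ⟨a, b, rfl⟩ := hH x (hu x (Finsupp.mem_support_iff.1 hx))
  refine ⟨b, AddMonoidAlgebra.single a (u.coeff (θ a - θ b)), ?_⟩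
  rw [AddMonoidAlgebra.single_mul_single, sub_add_cancel, mul_one]
  exact AddMonoidAlgebra.mapDomain_single.symm

lemma isUnit_single (g : G) : IsUnit (AddMonoidAlgebra.single g (1 : K)) :=
  IsUnit.of_mul_eq_one (AddMonoidAlgebra.single (-g) 1) (by
    rw [AddMonoidAlgebra.single_mul_single, add_neg_cancel, mul_one, AddMonoidAlgebra.one_def])

/-- A finitely generated subgroup of a torsion-free group is the difference group of a copy
of `ℕⁿ`. -/
lemma exists_injective_of_finite [IsAddTorsionFree G] (T : Set G) (hT : T.Finite) :
    ∃ (n : ℕ) (θ : (Fin n →₀ ℕ) →+ G), Function.Injective θ ∧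
      ∀ x ∈ T, ∃ a b, x = θ a - θ b := by
  let W : Submodule ℤ G := Submodule.span ℤ T
  have : Module.Finite ℤ W := Module.Finite.span_of_finite ℤ hT
  let b := Module.finBasis ℤ W
  let κ : (Fin (Module.finrank ℤ W) →₀ ℕ) →+ (Fin (Module.finrank ℤ W) →₀ ℤ) :=
    Finsupp.mapRange.addMonoidHom (Nat.castAddMonoidHom ℤ)
  have hκ : ∀ x i, κ x i = (x i : ℤ) := fun x i => rfl
  let σ : (Fin (Module.finrank ℤ W) →₀ ℤ) →+ G :=
    (W.subtype ∘ₗ (b.repr.symm : _ →ₗ[ℤ] W)).toAddMonoidHom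
  have hσ : Function.Injective σ := Subtype.val_injective.comp b.repr.symm.injective
  refine ⟨_, σ.comp κ, hσ.comp fun x y hxy => ?_, fun x hx => ?_⟩
  · ext i
    have := DFunLike.congr_fun hxy i
    rw [hκ, hκ] at this
    exact_mod_cast this
  -- The positive and negative parts of the integer coordinates give the two elements of `ℕⁿ`.
  · let z := b.repr ⟨x, Submodule.subset_span hx⟩
    refine ⟨z.mapRange Int.toNat rfl, (-z).mapRange Int.toNat rfl, ?_⟩
    have hz : κ (z.mapRange Int.toNat rfl) - κ ((-z).mapRange Int.toNat rfl) = z := by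
      ext i
      rw [Finsupp.sub_apply, hκ, hκ, Finsupp.mapRange_apply, Finsupp.mapRange_apply,
        Finsupp.neg_apply]
      exact Int.toNat_sub_toNat_neg _
    rw [AddMonoidHom.comp_apply, AddMonoidHom.comp_apply, ← map_sub, hz]
    simp [σ, z]

/-- A relation `b * c = a * d` has finitely many exponents, which span a free group of finite rank.
Up to monomials, which are units of `K[G]`, it takes place in a polynomial ring, where every element
is primal. -/
instance [IsAddTorsionFree G] : DecompositionMonoid (AddMonoidAlgebra K G) where
  primal a b c := by
    classical
    rintro ⟨d, hd⟩
    let T : Set G :=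
      (a.coeff.support ∪ b.coeff.support ∪ (c.coeff.support ∪ d.coeff.support) : Finset G)
    obtain ⟨n, θ, hθ, hT⟩ := exists_injective_of_finite T (Finset.finite_toSet _)
    obtain ⟨k, A, hA⟩ := exists_mul_single_eq_mapDomainRingHom θ hT (u := a)
      fun x hx => by simp [T, hx]
    obtain ⟨l, B, hB⟩ := exists_mul_single_eq_mapDomainRingHom θ hT (u := b)
      fun x hx => by simp [T, hx]
    obtain ⟨p, C, hC⟩ := exists_mul_single_eq_mapDomainRingHom θ hT (u := c)
      fun x hx => by simp [T, hx]
    obtain ⟨q, E, hE⟩ := exists_mul_single_eq_mapDomainRingHom θ hT (u := d)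
      fun x hx => by simp [T, hx]
    set Θ := AddMonoidAlgebra.mapDomainRingHom K θ with hΘ
    have hΘinj : Function.Injective Θ := AddMonoidAlgebra.mapDomain_injective hθ
    have hΘs : ∀ s, Θ (AddMonoidAlgebra.single s 1) = AddMonoidAlgebra.single (θ s) 1 :=
      fun s => AddMonoidAlgebra.mapDomain_single
    have : DecompositionMonoid (AddMonoidAlgebra K (Fin n →₀ ℕ)) :=
      inferInstanceAs (DecompositionMonoid (MvPolynomial (Fin n) K))
    -- Monomials are not units in the polynomial ring, so the shifts of all four elements have to be
    -- balanced on the two sides.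
    have hdvd : A ∣ (B * AddMonoidAlgebra.single k 1 * AddMonoidAlgebra.single q 1) * C := by
      refine ⟨E * AddMonoidAlgebra.single l 1 * AddMonoidAlgebra.single p 1, hΘinj ?_⟩
      simp only [map_mul, ← hA, ← hB, ← hC, ← hE, hΘs]
      linear_combination (AddMonoidAlgebra.single (θ l) 1 * AddMonoidAlgebra.single (θ k) 1 *
        AddMonoidAlgebra.single (θ q) 1 * AddMonoidAlgebra.single (θ p) 1) * hd
    obtain ⟨A₁, A₂, h1, h2, rfl⟩ := exists_dvd_and_dvd_of_dvd_mul hdvd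
    obtain ⟨v, hv⟩ := isUnit_single (K := K) (θ k)
    refine ⟨Θ A₁ * ↑v⁻¹, Θ A₂, ?_, ?_, ?_⟩
    · rw [Units.mul_right_dvd]
      have := map_dvd Θ h1
      rw [map_mul, map_mul, ← hB, hΘs, hΘs] at this
      rwa [(isUnit_single _).dvd_mul_right, (isUnit_single _).dvd_mul_right,
        (isUnit_single _).dvd_mul_right] at this
    · have := map_dvd Θ h2
      rwa [← hC, (isUnit_single _).dvd_mul_right] at this
    · rw [map_mul, ← hv] at hA
      rw [mul_right_comm, ← hA, Units.mul_inv_cancel_right]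

end Decomposition

/-- The group algebra of a torsion-free group with the ascending chain condition on cyclic
subgroups is factorial. -/
lemma ACCOnCyclicSubgroups.uniqueFactorizationMonoid {K G : Type*} [Field K] [AddCommGroup G]
    [IsAddTorsionFree G] (hG : ACCOnCyclicSubgroups G) :
    UniqueFactorizationMonoid (AddMonoidAlgebra K G) :=
  -- Termination gives factorizations into irreducibles, and primality of all elements makes
  -- irreducibles prime.
  have := hG.wfDvdMonoid (K := K)
  inferInstance

/-! ### Gauss lemmas for coefficients and for exponents -/

section Gauss

/-- Over a local ring `A`, an element of `K[G]` has coefficients in `A` if some multiple of it by an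
element of `A[G]` with a unit coefficient has. -/
lemma coeff_mem_range_of_mul {A K G : Type*} [CommRing A] [IsLocalRing A] [CommRing K] [Algebra A K]
    [AddMonoid G] [UniqueSums G] {u : AddMonoidAlgebra K G} {s : AddMonoidAlgebra A G}
    (hs : ∃ h, IsUnit (s.coeff h))
    (hus : ∀ g, (u * AddMonoidAlgebra.mapRingHom G (algebraMap A K) s).coeff g ∈
      LinearMap.range (Algebra.linearMap A K)) (g : G) :
    u.coeff g ∈ LinearMap.range (Algebra.linearMap A K) := by
  classical
  set N := LinearMap.range (Algebra.linearMap A K) with hN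
  set U : Submodule A K := Submodule.span A (u.coeff.support.image u.coeff : Finset K) with hU
  have hmemU : ∀ g, u.coeff g ∈ U := fun g => by
    by_cases hg : u.coeff g = 0
    · rw [hg]
      exact U.zero_mem
    · exact Submodule.subset_span (Finset.mem_coe.2
        (Finset.mem_image_of_mem _ (Finsupp.mem_support_iff.2 hg)))
  -- `U` is finitely generated, so by Nakayama it lies in `N` once it lies in `N` plus the maximal
  -- ideal times `U`.
  set W := N ⊔ IsLocalRing.maximalIdeal A • U with hW
  suffices hUW : ∀ g, u.coeff g ∈ W by
    refine Submodule.le_of_le_smul_of_le_jacobson_bot (I := IsLocalRing.maximalIdeal A)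
      (N := N) (N' := U) ⟨_, rfl⟩ (IsLocalRing.jacobson_eq_maximalIdeal ⊥ bot_ne_top).ge ?_ (hmemU g)
    rw [hU, Submodule.span_le]
    intro x hx
    obtain ⟨g, -, rfl⟩ := Finset.mem_image.1 (Finset.mem_coe.1 hx)
    exact hUW g
  by_contra! hcon
  obtain ⟨g₁, hg₁⟩ := hcon
  obtain ⟨h₁, hh₁⟩ := hs
  have hne : ∀ g, u.coeff g ∉ W → g ∈ u.coeff.support := fun g hg =>
    Finsupp.mem_support_iff.2 fun h => hg (h ▸ W.zero_mem)
  have hne' : ∀ h, IsUnit (s.coeff h) → h ∈ s.coeff.support := fun h hh =>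
    Finsupp.mem_support_iff.2 hh.ne_zero
  -- Only coefficients of `u` outside `W` and unit coefficients of `s` matter modulo `W`. At a
  -- unique sum of their exponents a single term survives, while the coefficient of the product is
  -- in `W`.
  obtain ⟨g₀, hg₀, h₀, hh₀, huniq⟩ := UniqueSums.uniqueAdd_of_nonempty
    (A := u.coeff.support.filter fun g => u.coeff g ∉ W)
    (B := s.coeff.support.filter fun h => IsUnit (s.coeff h))
    ⟨g₁, Finset.mem_filter.2 ⟨hne _ hg₁, hg₁⟩⟩ ⟨h₁, Finset.mem_filter.2 ⟨hne' _ hh₁, hh₁⟩⟩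
  obtain ⟨hg₀s, hg₀⟩ := Finset.mem_filter.1 hg₀
  obtain ⟨hh₀s, hh₀⟩ := Finset.mem_filter.1 hh₀
  have hsum : (u * AddMonoidAlgebra.mapRingHom G (algebraMap A K) s).coeff (g₀ + h₀) =
      ∑ p ∈ u.coeff.support ×ˢ s.coeff.support,
        if p.1 + p.2 = g₀ + h₀ then s.coeff p.2 • u.coeff p.1 else 0 := by
    rw [AddMonoidAlgebra.coeff_mul, Finset.sum_product, Finsupp.sum]
    refine Finset.sum_congr rfl fun x _ => ?_
    rw [AddMonoidAlgebra.coe_mapRingHom, AddMonoidAlgebra.coeff_map,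
      Finsupp.sum_mapRange_index (by simp), Finsupp.sum]
    refine Finset.sum_congr rfl fun y _ => ?_
    simp only [Algebra.smul_def, mul_comm]
    rfl
  rw [← Finset.add_sum_erase _ _ (Finset.mk_mem_product hg₀s hh₀s), if_pos rfl] at hsum
  have hrest : ∑ p ∈ (u.coeff.support ×ˢ s.coeff.support).erase (g₀, h₀),
      (if p.1 + p.2 = g₀ + h₀ then s.coeff p.2 • u.coeff p.1 else 0) ∈ W := by
    refine W.sum_mem fun p hp => ?_
    obtain ⟨hpne, hp⟩ := Finset.mem_erase.1 hp
    obtain ⟨hp1, hp2⟩ := Finset.mem_product.1 hp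
    split_ifs with hadd
    · by_cases hpW : u.coeff p.1 ∈ W
      · exact W.smul_mem _ hpW
      by_cases hpu : IsUnit (s.coeff p.2)
      · obtain ⟨h1, h2⟩ := huniq (Finset.mem_filter.2 ⟨hp1, hpW⟩) (Finset.mem_filter.2 ⟨hp2, hpu⟩) hadd
        exact absurd (Prod.ext h1 h2) hpne
      · exact (le_sup_right : _ ≤ W) (Submodule.smul_mem_smul
          ((IsLocalRing.mem_maximalIdeal _).2 hpu) (hmemU _))
    · exact W.zero_mem
  have hmem : s.coeff h₀ • u.coeff g₀ ∈ W := by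
    rw [eq_comm, ← eq_sub_iff_add_eq] at hsum
    rw [hsum]
    exact W.sub_mem ((le_sup_left : N ≤ W) (hus _)) hrest
  obtain ⟨v, hv⟩ := hh₀
  rw [← hv] at hmem
  exact hg₀ (by simpa [smul_smul] using W.smul_mem (↑v⁻¹ : A) hmem)

/-- An element outside `P[G]` has a coefficient that is a unit in the local ring `D_P`, so the
preceding lemma applies over `D_P`. -/
lemma coeff_mem_ringLocalizationAt {D G : Type*} [CommRing D] [IsDomain D]
    [AddCancelCommMonoid G] [IsAddTorsionFree G] {P : Ideal D} (hP : P.IsPrime)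
    {u : AddMonoidAlgebra (FractionRing D) G} {s a : AddMonoidAlgebra D G}
    (hs : s ∉ coeffIdeal G P) (h : u * toFractionAlgebra D G s = toFractionAlgebra D G a) (g : G) :
    u.coeff g ∈ ringLocalizationAt P := by
  have hunit : ∀ y : P.primeCompl, IsUnit (algebraMap D (FractionRing D) y) := fun y => by
    rw [isUnit_iff_ne_zero, Ne, FaithfulSMul.algebraMap_eq_zero_iff]
    exact fun h0 => y.2 (h0 ▸ P.zero_mem)
  let φ : Localization.AtPrime P →+* FractionRing D :=
    IsLocalization.lift (M := P.primeCompl) (g := algebraMap D (FractionRing D)) hunit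
  have hφ : ∀ d, φ (algebraMap D _ d) = algebraMap D (FractionRing D) d :=
    IsLocalization.lift_eq hunit
  let _ : Algebra (Localization.AtPrime P) (FractionRing D) := φ.toAlgebra
  have hmap : ∀ f : AddMonoidAlgebra D G, AddMonoidAlgebra.mapRingHom G
      (algebraMap (Localization.AtPrime P) (FractionRing D))
      (AddMonoidAlgebra.mapRingHom G (algebraMap D (Localization.AtPrime P)) f) =
      toFractionAlgebra D G f := fun f => by
    ext x
    rw [AddMonoidAlgebra.coeff_mapRingHom, AddMonoidAlgebra.coeff_mapRingHom,
      coeff_toFractionAlgebra]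
    exact hφ _
  obtain ⟨z, hz⟩ := coeff_mem_range_of_mul (A := Localization.AtPrime P) (u := u)
    (s := AddMonoidAlgebra.mapRingHom G (algebraMap D (Localization.AtPrime P)) s) (by
      simp only [mem_coeffIdeal, not_forall] at hs
      obtain ⟨x, hx⟩ := hs
      refine ⟨x, ?_⟩
      rw [AddMonoidAlgebra.coeff_mapRingHom]
      exact IsLocalization.map_units _ (⟨_, hx⟩ : P.primeCompl)) (fun x => by
      rw [hmap, h, coeff_toFractionAlgebra]
      exact ⟨algebraMap D _ _, hφ _⟩) g
  obtain ⟨d, t, rfl⟩ := IsLocalization.exists_mk'_eq P.primeCompl z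
  refine ⟨d, t, t.2, ?_⟩
  rw [← hz, ← hφ, ← hφ, Algebra.linearMap_apply]
  change φ _ * _ = _
  rw [← map_mul, IsLocalization.mk'_spec]

variable {K S : Type*} [CommRing K] [AddCancelCommMonoid S]

lemma add_mem_monoidLocalizationAt {P : AddSemigroupIdeal S} (hP : IsPrimeIdeal P)
    {x y : GrothendieckAddGroup S} (hx : x ∈ monoidLocalizationAt P)
    (hy : y ∈ monoidLocalizationAt P) : x + y ∈ monoidLocalizationAt P := by
  obtain ⟨a, b, hb, rfl⟩ := hx
  obtain ⟨c, d, hd, rfl⟩ := hy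
  refine ⟨a + c, b + d, fun h => (hP.mem_or_mem h).elim hb hd, ?_⟩
  rw [map_add, map_add]
  abel

variable [IsDomain K] [IsAddTorsionFree S] in
-- If `u` had exponents outside `S_P`, a minimal class of them would meet the exponents of `s`
-- outside `P` in a sum that nothing else can reach. That sum is an exponent of the product, hence
-- in `S`, which puts the exponent of `u` back into `S_P`.
lemma mem_monoidLocalizationAt_of_mul {P : AddSemigroupIdeal S} (hP : IsPrimeIdeal P)
    {u : AddMonoidAlgebra K (GrothendieckAddGroup S)} {s a : AddMonoidAlgebra K S}
    (hs : s ∉ exponentIdeal K P) (h : u * toGroupAlgebra K S s = toGroupAlgebra K S a)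
    {g : GrothendieckAddGroup S} (hg : u.coeff g ≠ 0) : g ∈ monoidLocalizationAt P := by
  classical
  have hadd : ∀ {x y}, x ∈ monoidLocalizationAt P → y ∈ monoidLocalizationAt P →
      x + y ∈ monoidLocalizationAt P := add_mem_monoidLocalizationAt hP
  have hof : ∀ {b c : S}, c ∉ P → (GrothendieckAddGroup.of b - GrothendieckAddGroup.of c :
      GrothendieckAddGroup S) ∈ monoidLocalizationAt P := fun {b c} hc => ⟨b, c, hc, rfl⟩
  have hof0 : ∀ b : S, GrothendieckAddGroup.of b ∈ monoidLocalizationAt P := fun b =>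
    ⟨b, 0, hP.zero_notMem, by rw [map_zero, sub_zero]⟩
  -- Divisibility with respect to `S_P`; it is only a preorder because `S_P` may have units.
  let _ : Preorder (GrothendieckAddGroup S) :=
    { le := fun x y => y - x ∈ monoidLocalizationAt P
      le_refl := fun x => by
        rw [sub_self, ← map_zero (GrothendieckAddGroup.of : S →+ GrothendieckAddGroup S)]
        exact hof0 0
      le_trans := fun x y z hxy hyz => by
        rw [← sub_add_sub_cancel z y x]
        exact hadd hyz hxy }
  by_contra hgP
  obtain ⟨m, hm⟩ := (u.coeff.support.filter (· ∉ monoidLocalizationAt P)).exists_minimal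
    ⟨g, Finset.mem_filter.2 ⟨Finsupp.mem_support_iff.2 hg, hgP⟩⟩
  simp only [mem_exponentIdeal, not_forall] at hs
  obtain ⟨b₁, hb₁, hb₁P⟩ := hs
  obtain ⟨g₀, hg₀, h₀, hh₀, huniq⟩ := UniqueSums.uniqueAdd_of_nonempty
    (A := u.coeff.support.filter fun g => g ∉ monoidLocalizationAt P ∧
      m - g ∈ monoidLocalizationAt P)
    (B := (s.coeff.support.filter (· ∉ P)).image GrothendieckAddGroup.of)
    ⟨m, Finset.mem_filter.2 ⟨(Finset.mem_filter.1 hm.1).1, (Finset.mem_filter.1 hm.1).2,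
      le_refl m⟩⟩
    ⟨_, Finset.mem_image_of_mem _ (Finset.mem_filter.2 ⟨Finsupp.mem_support_iff.2 hb₁, hb₁P⟩)⟩
  obtain ⟨hg₀u, hg₀P, hg₀m⟩ := Finset.mem_filter.1 hg₀
  obtain ⟨b₀, hb₀, rfl⟩ := Finset.mem_image.1 hh₀
  obtain ⟨hb₀s, hb₀P⟩ := Finset.mem_filter.1 hb₀
  -- Any competing pair `x, b` has `x` below `g₀`, hence outside `S_P` and, by minimality of `m`,
  -- equivalent to `m`. Then `b₀ - b ∈ S_P`, so `b ∉ P` and the pair already competes in the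
  -- restricted sets.
  have hfull : UniqueAdd u.coeff.support (toGroupAlgebra K S s).coeff.support g₀
      (GrothendieckAddGroup.of b₀) := by
    intro x y hx hy hxy
    obtain ⟨b, rfl, hb⟩ := exists_of_coeff_toGroupAlgebra_ne_zero (Finsupp.mem_support_iff.1 hy)
    have hg₀x : g₀ - x ∈ monoidLocalizationAt P := by
      rw [show g₀ - x = GrothendieckAddGroup.of b - GrothendieckAddGroup.of b₀ by
        rw [sub_eq_sub_iff_add_eq_add, ← hxy, add_comm]]
      exact hof hb₀P
    have hxP : x ∉ monoidLocalizationAt P := fun hxP => hg₀P (by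
      rw [← sub_add_cancel g₀ x]
      exact hadd hg₀x hxP)
    have hmx : m - x ∈ monoidLocalizationAt P := by
      rw [← sub_add_sub_cancel m g₀ x]
      exact hadd hg₀m hg₀x
    have hxm : x - m ∈ monoidLocalizationAt P :=
      hm.2 (Finset.mem_filter.2 ⟨hx, hxP⟩) hmx
    have hbP : b ∉ P := by
      have : (GrothendieckAddGroup.of b₀ - GrothendieckAddGroup.of b : GrothendieckAddGroup S) ∈
          monoidLocalizationAt P := by
        rw [show (GrothendieckAddGroup.of b₀ - GrothendieckAddGroup.of b :
            GrothendieckAddGroup S) = (x - m) + (m - g₀) by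
          rw [sub_add_sub_cancel, sub_eq_sub_iff_add_eq_add, hxy, add_comm]]
        exact hadd hxm hg₀m
      obtain ⟨c, d, hd, hcd⟩ := this
      intro hb
      have h1 : b₀ + d ∈ P := by
        rw [of_sub_of_eq_iff.1 hcd]
        exact AddSemigroupIdeal.add_mem P c hb
      exact (hP.mem_or_mem h1).elim hb₀P hd
    exact huniq (Finset.mem_filter.2 ⟨hx, hxP, hmx⟩) (Finset.mem_image_of_mem _
      (Finset.mem_filter.2 ⟨Finsupp.mem_support_iff.2 hb, hbP⟩)) hxy
  have hne : (u * toGroupAlgebra K S s).coeff (g₀ + GrothendieckAddGroup.of b₀) ≠ 0 := by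
    rw [AddMonoidAlgebra.coeff_mul_add_of_uniqueAdd hfull, coeff_toGroupAlgebra_of]
    exact mul_ne_zero (Finsupp.mem_support_iff.1 hg₀u) (Finsupp.mem_support_iff.1 hb₀s)
  rw [h] at hne
  obtain ⟨c, hc, -⟩ := exists_of_coeff_toGroupAlgebra_ne_zero hne
  refine hg₀P ?_
  rw [eq_sub_of_add_eq hc]
  exact hof hb₀P

end Gauss

/-! ### The two directions of the theorem -/

section Main

variable {D S : Type*} [CommRing D] [AddCancelCommMonoid S]

lemma exists_add_eq_of_coeff_single_mul {s t : S} {d : D} {f : AddMonoidAlgebra D S}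
    (h : (AddMonoidAlgebra.single s d * f).coeff t ≠ 0) : ∃ c, t = s + c := by
  by_contra! hcon
  exact h (AddMonoidAlgebra.coeff_single_mul_of_forall_add_ne d f fun c hc => hcon c hc.symm)

lemma toFractionAlgebra_toGroupAlgebra (f : AddMonoidAlgebra D S) :
    toFractionAlgebra D (GrothendieckAddGroup S) (toGroupAlgebra D S f) =
      toGroupAlgebra (FractionRing D) S (toFractionAlgebra D S f) :=
  RingHom.congr_fun (AddMonoidAlgebra.mapRingHom_comp_mapDomainRingHom _ _) f

variable [IsDomain D] [IsAddTorsionFree S]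

/-- A monomial in `D[P]` lies in a height-one prime below `D[P]`. That prime is some `D[P']` with
`P' ≤ P`, and minimality of `P` gives equality. -/
lemma exponentIdeal_mem_of_isWeaklyKrullDomain
    (hR : IsWeaklyKrullDomain (AddMonoidAlgebra D S)) {P : AddSemigroupIdeal S}
    (hP : P ∈ minimalPrimeIdeals S) :
    exponentIdeal D P ∈ heightOneSpectrum (AddMonoidAlgebra D S) := by
  obtain ⟨⟨hPp, s, hs⟩, hmin⟩ := hP
  obtain ⟨Q, hQ, hsQ, hQP⟩ := hR.exists_heightOne_le (isPrime_exponentIdeal (D := D) hPp)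
    (AddMonoidAlgebra.single_ne_zero.2 one_ne_zero) ((single_mem_exponentIdeal one_ne_zero).2 hs)
  obtain ⟨P', hP', rfl⟩ := exists_eq_exponentIdeal hQ hsQ
  have hle : P' ≤ P := fun t ht => (single_mem_exponentIdeal (D := D) one_ne_zero).1
    (hQP ((single_mem_exponentIdeal one_ne_zero).2 ht))
  rwa [le_antisymm (hmin hP'.1 hle) hle]

lemma coeffIdeal_mem_of_isWeaklyKrullDomain
    (hR : IsWeaklyKrullDomain (AddMonoidAlgebra D S)) {P : Ideal D}
    (hP : P ∈ heightOneSpectrum D) :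
    coeffIdeal S P ∈ heightOneSpectrum (AddMonoidAlgebra D S) := by
  obtain ⟨hPp, hP0, hmin⟩ := mem_heightOneSpectrum_iff.1 hP
  obtain ⟨d, hd, hd0⟩ := Submodule.exists_mem_ne_zero_of_ne_bot hP0
  obtain ⟨Q, hQ, hdQ, hQP⟩ := hR.exists_heightOne_le (isPrime_coeffIdeal (S := S) hPp)
    (AddMonoidAlgebra.single_ne_zero.2 hd0) ((single_mem_coeffIdeal (s := 0)).2 hd)
  obtain ⟨P', hP', rfl⟩ := exists_eq_coeffIdeal hQ hd0 hdQ
  have hle : P' ≤ P := fun t ht => (single_mem_coeffIdeal (S := S) (s := 0)).1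
    (hQP (single_mem_coeffIdeal.2 ht))
  rwa [← hmin P' hP'.1 (mem_heightOneSpectrum_iff.1 hP').2.1 hle]

/-- Divisibility in `S` is divisibility of monomials in `D[S]`, and the height-one primes containing
a monomial come from minimal primes of `S`. -/
lemma isWeaklyKrullMonoid_of_monoidAlgebra (hR : IsWeaklyKrullDomain (AddMonoidAlgebra D S)) :
    IsWeaklyKrullMonoid S := by
  obtain ⟨h1, h2⟩ := isWeaklyKrullDomain_iff.1 hR
  refine isWeaklyKrullMonoid_iff.2 ⟨fun a b h => ?_, fun x hx => ?_⟩
  · obtain ⟨f, hf⟩ := h1 (AddMonoidAlgebra.single a 1) (AddMonoidAlgebra.single b 1)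
      (AddMonoidAlgebra.single_ne_zero.2 one_ne_zero) fun Q hQ => by
        by_cases hb : AddMonoidAlgebra.single b 1 ∈ Q
        · obtain ⟨P, hP, rfl⟩ := exists_eq_exponentIdeal hQ hb
          obtain ⟨d, hd, c, hc⟩ := h P hP
          refine ⟨AddMonoidAlgebra.single d 1,
            fun h => hd ((single_mem_exponentIdeal one_ne_zero).1 h),
            AddMonoidAlgebra.single c 1, ?_⟩
          rw [AddMonoidAlgebra.single_mul_single, AddMonoidAlgebra.single_mul_single, add_comm d,
            hc]
        · exact ⟨_, hb, dvd_mul_right _ _⟩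
    refine exists_add_eq_of_coeff_single_mul (d := (1 : D)) (f := f) ?_
    rw [← hf]
    simp
  · have hxu : ¬ IsUnit (AddMonoidAlgebra.single x (1 : D)) := fun hu => hx (by
      obtain ⟨f, hf⟩ := hu.exists_right_inv
      obtain ⟨c, hc⟩ := exists_add_eq_of_coeff_single_mul (s := x) (t := 0) (d := (1 : D)) (f := f)
        (by rw [hf, AddMonoidAlgebra.one_def]; simp)
      exact IsAddUnit.of_add_eq_zero c hc.symm)
    refine ((h2 _ (AddMonoidAlgebra.single_ne_zero.2 one_ne_zero) hxu).preimage
      (exponentIdeal_injective (D := D)).injOn).subset ?_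
    rintro P ⟨hP, hxP⟩
    exact ⟨exponentIdeal_mem_of_isWeaklyKrullDomain hR hP,
      (single_mem_exponentIdeal one_ne_zero).2 hxP⟩

lemma isWeaklyKrullDomain_of_monoidAlgebra (hR : IsWeaklyKrullDomain (AddMonoidAlgebra D S)) :
    IsWeaklyKrullDomain D := by
  obtain ⟨h1, h2⟩ := isWeaklyKrullDomain_iff.1 hR
  refine isWeaklyKrullDomain_iff.2 ⟨fun a b hb0 h => ?_, fun x hx0 hx => ?_⟩
  · obtain ⟨f, hf⟩ := h1 (AddMonoidAlgebra.single 0 a) (AddMonoidAlgebra.single 0 b)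
      (AddMonoidAlgebra.single_ne_zero.2 hb0) fun Q hQ => by
        by_cases hb : AddMonoidAlgebra.single 0 b ∈ Q
        · obtain ⟨P, hP, rfl⟩ := exists_eq_coeffIdeal hQ hb0 hb
          obtain ⟨d, hd, c, hc⟩ := h P hP
          refine ⟨AddMonoidAlgebra.single 0 d, fun h => hd (single_mem_coeffIdeal.1 h),
            AddMonoidAlgebra.single 0 c, ?_⟩
          rw [AddMonoidAlgebra.single_mul_single, AddMonoidAlgebra.single_mul_single, hc]
        · exact ⟨_, hb, dvd_mul_right _ _⟩
    refine ⟨f.coeff 0, ?_⟩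
    rw [← AddMonoidAlgebra.coeff_single_zero_mul, ← hf]
    simp
  · have hxu : ¬ IsUnit (AddMonoidAlgebra.single (0 : S) x) := fun hu => hx (by
      obtain ⟨f, hf⟩ := hu.exists_right_inv
      refine IsUnit.of_mul_eq_one (f.coeff 0) ?_
      rw [← AddMonoidAlgebra.coeff_single_zero_mul, hf, AddMonoidAlgebra.one_def]
      simp)
    refine ((h2 _ (AddMonoidAlgebra.single_ne_zero.2 hx0) hxu).preimage
      (coeffIdeal_injective (S := S)).injOn).subset ?_
    rintro P ⟨hP, hxP⟩
    exact ⟨coeffIdeal_mem_of_isWeaklyKrullDomain hR hP, single_mem_coeffIdeal.2 hxP⟩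

lemma isWeaklyKrullDomain_monoidAlgebra (hS : IsWeaklyKrullMonoid S) (hD : IsWeaklyKrullDomain D)
    (hK : IsWeaklyKrullDomain (AddMonoidAlgebra (FractionRing D) (GrothendieckAddGroup S)))
    (hXS : ∀ P ∈ minimalPrimeIdeals S,
      exponentIdeal D P ∈ heightOneSpectrum (AddMonoidAlgebra D S))
    (hXD : ∀ P ∈ heightOneSpectrum D,
      coeffIdeal S P ∈ heightOneSpectrum (AddMonoidAlgebra D S)) :
    IsWeaklyKrullDomain (AddMonoidAlgebra D S) := by
  set i := (toGroupAlgebra (FractionRing D) S).comp (toFractionAlgebra D S) with hi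
  have hinj : Function.Injective i := toGroupAlgebra_injective.comp toFractionAlgebra_injective
  obtain ⟨hK1, hK2⟩ := isWeaklyKrullDomain_iff.1 hK
  refine isWeaklyKrullDomain_iff.2 ⟨fun a b hb h => ?_, fun x hx0 _ => ?_⟩
  · have hib : i b ≠ 0 := fun h0 => hb (hinj (by rw [h0, map_zero]))
    -- `u` is the fraction `a / b`, already known to lie in `K[G]`. The primes `D[P]` will control
    -- its exponents and the primes `P[S]` its coefficients.
    obtain ⟨u, hu⟩ := hK1 (i a) (i b) hib fun Q hQ => by
      have hQp := hQ.1
      obtain ⟨s, hs, hd⟩ := h (Q.comap i) (by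
        rw [hi, ← Ideal.comap_comap]
        exact (comap_toFractionAlgebra_mem_iff (hQp.comap _)).2
          ((comap_toGroupAlgebra_mem_iff hQp).2 hQ))
      refine ⟨i s, hs, ?_⟩
      rw [← map_mul]
      exact map_dvd i hd
    have hmul : ∀ s r, s * a = b * r → u * i s = i r := fun s r hsr => by
      apply mul_left_cancel₀ hib
      rw [← map_mul, ← hsr, map_mul, hu]
      ring
    have hexp : ∀ g, u.coeff g ≠ 0 → g ∈ Set.range (GrothendieckAddGroup.of : S →+ _) := by
      intro g hg
      rw [← hS.iInter_localization]
      refine Set.mem_iInter₂.2 fun P hP => ?_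
      obtain ⟨s, hs, r, hr⟩ := h _ (hXS P hP)
      refine mem_monoidLocalizationAt_of_mul hP.1.1 (s := toFractionAlgebra D S s)
        (a := toFractionAlgebra D S r) ?_ (hmul s r hr) hg
      rwa [← Ideal.mem_comap, comap_toFractionAlgebra_exponentIdeal]
    have hcoeff : ∀ g, u.coeff g ∈ Set.range (algebraMap D (FractionRing D)) := by
      intro g
      rw [← hD.iInter_localization]
      refine Set.mem_iInter₂.2 fun P hP => ?_
      obtain ⟨s, hs, r, hr⟩ := h _ (hXD P hP)
      refine coeff_mem_ringLocalizationAt hP.1 (s := toGroupAlgebra D S s)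
        (a := toGroupAlgebra D S r) ?_ ?_ g
      · rwa [← Ideal.mem_comap, comap_toGroupAlgebra_coeffIdeal]
      · rw [toFractionAlgebra_toGroupAlgebra, toFractionAlgebra_toGroupAlgebra]
        exact hmul s r hr
    obtain ⟨v, rfl⟩ : ∃ v, toFractionAlgebra D (GrothendieckAddGroup S) v = u := by
      have : u ∈ Set.range (AddMonoidAlgebra.map (M := GrothendieckAddGroup S)
          (algebraMap D (FractionRing D) : D →+ FractionRing D)) := by
        rw [AddMonoidAlgebra.range_map]
        exact hcoeff
      exact this
    obtain ⟨f, rfl⟩ := mem_range_toGroupAlgebra (u := v) fun g hg => hexp g (by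
      rw [coeff_toFractionAlgebra]
      simpa using hg)
    refine ⟨f, hinj ?_⟩
    rw [hu, map_mul, toFractionAlgebra_toGroupAlgebra]
    rfl
  -- One term of `x` suffices: `x ∈ P[S]` forces its coefficient into `P`, and `x ∈ D[P]` forces its
  -- exponent into `P`.
  · obtain ⟨s, hs⟩ : ∃ s, x.coeff s ≠ 0 := by
      by_contra! hcon
      exact hx0 (AddMonoidAlgebra.coeff_injective (Finsupp.ext hcon))
    have hfinD : {P ∈ heightOneSpectrum D | x.coeff s ∈ P}.Finite := by
      by_cases hu : IsUnit (x.coeff s)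
      · refine Set.finite_empty.subset ?_
        rintro P ⟨hP, hxP⟩
        exact hP.1.ne_top (Ideal.eq_top_of_isUnit_mem _ hxP hu)
      · exact hD.finite_character _ hs hu
    have hfinS : {P ∈ minimalPrimeIdeals S | s ∈ P}.Finite := by
      by_cases hu : IsAddUnit s
      · refine Set.finite_empty.subset ?_
        rintro P ⟨hP, hsP⟩
        obtain ⟨t, ht⟩ := hu.exists_neg'
        exact hP.1.1.zero_notMem (ht ▸ AddSemigroupIdeal.add_mem P t hsP)
      · exact hS.finite_character _ hu
    have hfinK : {Q ∈ heightOneSpectrum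
        (AddMonoidAlgebra (FractionRing D) (GrothendieckAddGroup S)) | i x ∈ Q}.Finite := by
      by_cases hu : IsUnit (i x)
      · refine Set.finite_empty.subset ?_
        rintro Q ⟨hQ, hxQ⟩
        exact hQ.1.ne_top (Ideal.eq_top_of_isUnit_mem _ hxQ hu)
      · exact hK2 _ (fun h0 => hx0 (hinj (by rw [h0, map_zero]))) hu
    refine ((hfinD.image (coeffIdeal S)).union ((hfinS.image (exponentIdeal D)).union
      (hfinK.image (Ideal.comap i)))).subset ?_
    rintro Q ⟨hQ, hxQ⟩
    obtain ⟨P, hP, rfl⟩ | ⟨P, hP, rfl⟩ | ⟨Q', hQ', rfl⟩ := mem_heightOneSpectrum_cases hQ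
    · exact Or.inl ⟨P, ⟨hP, hxQ s⟩, rfl⟩
    · exact Or.inr (Or.inl ⟨P, ⟨hP, hxQ s hs⟩, rfl⟩)
    · exact Or.inr (Or.inr ⟨Q', ⟨hQ', hxQ⟩, rfl⟩)

end Main

end MonoidAlgebraUMT

theorem theorem2p7 {D : Type*} [CommRing D] [IsDomain D]
    {S : Type*} [AddCancelCommMonoid S] [IsAddTorsionFree S]
    (hG : MonoidAlgebraUMT.ACCOnCyclicSubgroups (Algebra.GrothendieckAddGroup S)) :
    MonoidAlgebraUMT.IsWeaklyKrullDomain (AddMonoidAlgebra D S) ↔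
      (MonoidAlgebraUMT.IsWeaklyKrullMonoid S ∧
        MonoidAlgebraUMT.IsUMTMonoid S (FractionRing D)) ∧
      (MonoidAlgebraUMT.IsWeaklyKrullDomain D ∧
        MonoidAlgebraUMT.IsUMTDomain D (Algebra.GrothendieckAddGroup S)) := by
  rw [MonoidAlgebraUMT.isUMTMonoid_fractionRing_iff,
    MonoidAlgebraUMT.isUMTDomain_grothendieckAddGroup_iff]
  refine ⟨fun hR => ⟨⟨MonoidAlgebraUMT.isWeaklyKrullMonoid_of_monoidAlgebra hR, fun _ =>
      MonoidAlgebraUMT.exponentIdeal_mem_of_isWeaklyKrullDomain hR⟩,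
    MonoidAlgebraUMT.isWeaklyKrullDomain_of_monoidAlgebra hR, fun _ =>
      MonoidAlgebraUMT.coeffIdeal_mem_of_isWeaklyKrullDomain hR⟩, ?_⟩
  rintro ⟨⟨hS, hXS⟩, hD, hXD⟩
  -- The chain condition enters here, to make `K[G]` factorial and hence weakly Krull.
  have := hG.uniqueFactorizationMonoid (K := FractionRing D)
  exact MonoidAlgebraUMT.isWeaklyKrullDomain_monoidAlgebra hS hD
    MonoidAlgebraUMT.isWeaklyKrullDomain_of_uniqueFactorizationMonoid hXS hXD
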